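/- Let $N\ge 1$, $0<\beta<1$ and $1<q<\infty$, and put $q'=q/(q-1)$. For an open set $\Omega\subset\mathbb{R}^N$, $0<\alpha<1$ and $1\le r<\infty$ write $$[u]_{W^{\alpha,r}(\Omega)}=\left(\int_\Omega\int_\Omega\frac{|u(x)-u(y)|^r}{|x-y|^{N+\alpha r}}\,dx\,dy\right)^{1/r},\qquad W^{\alpha,r}(\Omega)=\{u\in L^r(\Omega):[u]_{W^{\alpha,r}(\Omega)}<+\infty\}.$$ For bounded $\Omega$ let $\mathcal{D}^{\alpha,r}_0(\Omega)$ be the completion of $C^\infty_0(\Omega)$ (smooth functions with compact support in $\Omega$) with respect to the norm $\varphi\mapsto[\varphi]_{W^{\alpha,r}(\mathbb{R}^N)}$, and let $\mathcal{D}^{\beta-1,q}(\Omega)$ be the topological dual of $\mathcal{D}^{1-\beta,q'}_0(\Omega)$, with the dual norm $$\|F\|_{\mathcal{D}^{\beta-1,q}(\Omega)}=\sup\left\{|\langle F,\varphi\rangle| : \varphi\in C^\infty_0(\Omega),\ [\varphi]_{W^{1-\beta,q'}(\mathbb{R}^N)}\le 1\right\}.$$ There is a constant $C=C(N,\beta,q)>0$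 such that for every open ball $B\subset\mathbb{R}^N$, every $f\in W^{\beta,q}(B)$ and every $j=1,\dots,N$, the distributional derivative $f_{x_j}$, i.e. the functional $\varphi\mapsto-\int_B f\,\varphi_{x_j}\,dx$ on $C^\infty_0(B)$, belongs to $\mathcal{D}^{\beta-1,q}(B)$ (it extends to an element of this dual space, which is unique by density) and $$\|f_{x_j}\|_{\mathcal{D}^{\beta-1,q}(B)}\le C\,[f]_{W^{\beta,q}(B)}.$$ -/

import Mathlib

open MeasureTheory Set TopologicalSpace
open scoped ENNReal Distributions LineDeriv

/-- The Gagliardo seminorm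
`[u]_{W^{β,q}(Ω)} = (∫_Ω ∫_Ω |u(x) - u(y)|^q / |x - y|^{N + βq} dx dy)^{1/q}`,
as an extended nonnegative real. (On the diagonal the integrand is `0 / 0 = 0`.) -/
noncomputable def gagliardo {N : ℕ} (Ω : Set (EuclideanSpace ℝ (Fin N))) (β q : ℝ)
    (u : EuclideanSpace ℝ (Fin N) → ℝ) : ℝ≥0∞ :=
  (∫⁻ x in Ω, ∫⁻ y in Ω, ‖u x - u y‖ₑ ^ q / ‖x - y‖ₑ ^ (N + β * q)) ^ (1 / q)

/-- Membership in the Sobolev-Slobodeckii space `W^{β,q}(Ω)`, `0 < β < 1`: the function is in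
`L^q(Ω)` and its Gagliardo seminorm over `Ω` is finite. -/
structure MemSlobodeckii {N : ℕ} (Ω : Set (EuclideanSpace ℝ (Fin N))) (β q : ℝ)
    (u : EuclideanSpace ℝ (Fin N) → ℝ) : Prop where
  memLp : MemLp u (ENNReal.ofReal q) (volume.restrict Ω)
  gagliardo_lt_top : gagliardo Ω β q u < ∞

section Auxiliary

variable {N : ℕ} {α r : ℝ}

theorem gagliardo_univ_eq_eLpNorm (α : ℝ) (hr : 1 ≤ r)
    {u : EuclideanSpace ℝ (Fin N) → ℝ} (hu : Continuous u) :
    gagliardo univ α r u =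
      eLpNorm (fun z : EuclideanSpace ℝ (Fin N) × EuclideanSpace ℝ (Fin N) =>
        (u z.1 - u z.2) / ‖z.1 - z.2‖ ^ ((N + α * r) / r)) (ENNReal.ofReal r)
        (volume.prod volume) := by
  have hr0 : 0 < r := by linarith
  have hm : Measurable (fun z : EuclideanSpace ℝ (Fin N) × EuclideanSpace ℝ (Fin N) =>
        (u z.1 - u z.2) / ‖z.1 - z.2‖ ^ ((N + α * r) / r)) := by
    have := hu.measurable
    fun_prop
  rw [eLpNorm_eq_lintegral_rpow_enorm_toReal (by simpa using hr0) (by simp),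
    ENNReal.toReal_ofReal hr0.le, lintegral_prod _ (by fun_prop), gagliardo]
  simp only [Measure.restrict_univ]
  congr 1
  refine lintegral_congr fun x => lintegral_congr fun y => ?_
  by_cases hxy : x = y
  · subst hxy
    simp [hr0]
  · have h0 : 0 < ‖x - y‖ := norm_pos_iff.2 (sub_ne_zero.2 hxy)
    have h1 : 0 < ‖x - y‖ ^ ((N + α * r) / r) := Real.rpow_pos_of_pos h0 _
    have h2 : ‖‖x - y‖ ^ ((N + α * r) / r)‖ₑ ^ r = ‖x - y‖ₑ ^ (N + α * r) := by
      rw [Real.enorm_of_nonneg h1.le, ← ENNReal.ofReal_rpow_of_pos h0, ofReal_norm,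
        ← ENNReal.rpow_mul, div_mul_cancel₀ _ hr0.ne']
    rw [div_eq_mul_inv (u x - u y), enorm_mul, enorm_inv h1.ne',
      ENNReal.mul_rpow_of_nonneg _ _ hr0.le, ENNReal.inv_rpow, h2, div_eq_mul_inv]

theorem gagliardo_univ_add_le (α : ℝ) (hr : 1 ≤ r)
    {u v : EuclideanSpace ℝ (Fin N) → ℝ} (hu : Continuous u) (hv : Continuous v) :
    gagliardo univ α r (fun x => u x + v x) ≤ gagliardo univ α r u + gagliardo univ α r v := by
  rw [gagliardo_univ_eq_eLpNorm α hr hu, gagliardo_univ_eq_eLpNorm α hr hv,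
    gagliardo_univ_eq_eLpNorm α hr (by fun_prop)]
  have hum := hu.measurable
  have hvm := hv.measurable
  refine le_trans (le_of_eq ?_) (eLpNorm_add_le ?_ ?_ ?_)
  · congr 1
    ext z
    simp only [Pi.add_apply]
    ring
  · exact Measurable.aestronglyMeasurable (by fun_prop)
  · exact Measurable.aestronglyMeasurable (by fun_prop)
  · simpa using hr

theorem gagliardo_univ_smul (α : ℝ) (hr : 1 ≤ r)
    {u : EuclideanSpace ℝ (Fin N) → ℝ} (hu : Continuous u) (c : ℝ) :
    gagliardo univ α r (fun x => c * u x) = ‖c‖ₑ * gagliardo univ α r u := by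
  rw [gagliardo_univ_eq_eLpNorm α hr hu, gagliardo_univ_eq_eLpNorm α hr (by fun_prop),
    ← eLpNorm_const_smul]
  congr 1
  ext z
  simp only [Pi.smul_apply, smul_eq_mul]
  ring

theorem lintegral_gagliardo_kernel_lt_top (hα : α ∈ Ioo (0 : ℝ) 1) (hr : 1 ≤ r) (hN : N ≠ 0) :
    ∫⁻ h : EuclideanSpace ℝ (Fin N),
      ENNReal.ofReal ((min 1 ‖h‖) ^ r / ‖h‖ ^ (N + α * r)) < ∞ := by
  have : NeZero N := ⟨hN⟩
  have hr0 : 0 < r := by linarith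
  have key : Integrable
      (fun h : EuclideanSpace ℝ (Fin N) => (min 1 ‖h‖) ^ r / ‖h‖ ^ (N + α * r)) volume := by
    rw [integrable_fun_norm_addHaar volume (f := fun s : ℝ => (min 1 s) ^ r / s ^ (N + α * r))]
    rw [← Ioc_union_Ioi_eq_Ioi (zero_le_one' ℝ)]
    refine IntegrableOn.union ?_ ?_
    · have h1 : IntegrableOn (fun s : ℝ => s ^ (r * (1 - α) - 1)) (Ioc 0 1) := by
        rw [← intervalIntegrable_iff_integrableOn_Ioc_of_le zero_le_one]
        apply intervalIntegral.intervalIntegrable_rpow'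
        have := mul_pos hr0 (sub_pos.2 hα.2)
        linarith
      refine h1.congr_fun (fun s hs => ?_) measurableSet_Ioc
      have hs0 : 0 < s := hs.1
      simp only [min_eq_right hs.2, finrank_euclideanSpace_fin, smul_eq_mul]
      rw [← Real.rpow_natCast, ← Real.rpow_sub hs0, ← Real.rpow_add hs0,
        Nat.cast_sub (Nat.one_le_iff_ne_zero.2 hN)]
      congr 1
      push_cast
      ring
    · have h1 : IntegrableOn (fun s : ℝ => s ^ (-1 - α * r)) (Ioi 1) := by
        apply integrableOn_Ioi_rpow_of_lt _ zero_lt_one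
        have := mul_pos hα.1 hr0
        linarith
      refine h1.congr_fun (fun s hs => ?_) measurableSet_Ioi
      have hs1 : 1 < s := hs
      have hs0 : 0 < s := by linarith
      simp only [min_eq_left hs1.le, finrank_euclideanSpace_fin, smul_eq_mul, Real.one_rpow]
      rw [← Real.rpow_natCast, one_div, ← Real.rpow_neg hs0.le, ← Real.rpow_add hs0,
        Nat.cast_sub (Nat.one_le_iff_ne_zero.2 hN)]
      congr 1
      push_cast
      ring
  exact key.lintegral_lt_top

/-- Compactly supported smooth functions have finite Gagliardo seminorm on the whole space. -/
theorem gagliardo_univ_lt_top (hα : α ∈ Ioo (0 : ℝ) 1) (hr : 1 ≤ r)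
    {u : EuclideanSpace ℝ (Fin N) → ℝ} (hu : ContDiff ℝ 1 u) (hc : HasCompactSupport u) :
    gagliardo univ α r u < ∞ := by
  have hr0 : 0 < r := by linarith
  rcases eq_or_ne N 0 with rfl | hN
  · have : ∀ x y : EuclideanSpace ℝ (Fin 0), u x - u y = 0 := fun x y => by
      rw [Subsingleton.elim x y, sub_self]
    simp [gagliardo, this, hr0]
  obtain ⟨L, hL⟩ := hu.lipschitzWith_of_hasCompactSupport hc one_ne_zero
  obtain ⟨M, hM⟩ := hu.continuous.bounded_above_of_compact_support hc
  have hM0 : 0 ≤ M := (norm_nonneg _).trans (hM 0)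
  set A : ℝ := L + 2 * M with hA
  have hL0 : (0 : ℝ) ≤ L := L.2
  have hA0 : 0 ≤ A := by positivity
  have hbound : ∀ x y, ‖u x - u y‖ ≤ A * min 1 ‖x - y‖ := fun x y => by
    have h1 : ‖u x - u y‖ ≤ L * ‖x - y‖ := hL.norm_sub_le x y
    have h2 : ‖u x - u y‖ ≤ 2 * M := (norm_sub_le _ _).trans (by linarith [hM x, hM y])
    rcases min_cases 1 ‖x - y‖ with ⟨h, _⟩ | ⟨h, _⟩ <;> rw [h]
    · linarith
    · nlinarith [norm_nonneg (x - y)]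
  set G : EuclideanSpace ℝ (Fin N) → ℝ≥0∞ :=
    fun h => ENNReal.ofReal ((min 1 ‖h‖) ^ r / ‖h‖ ^ (N + α * r)) with hG
  have hGm : Measurable G := by fun_prop
  have hGneg : ∀ x y, G (x - y) = G (y - x) := fun x y => by simp only [hG, norm_sub_rev]
  set K := tsupport u with hK
  have hKm : MeasurableSet K := (isClosed_tsupport u).measurableSet
  have hpt : ∀ x y, ‖u x - u y‖ₑ ^ r / ‖x - y‖ₑ ^ (N + α * r) ≤
      ENNReal.ofReal (A ^ r) *
        (K.indicator 1 x * G (x - y) + K.indicator 1 y * G (x - y)) := fun x y => by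
    by_cases hxy : x = y
    · subst hxy
      simp [hr0]
    have h0 : 0 < ‖x - y‖ := norm_pos_iff.2 (sub_ne_zero.2 hxy)
    by_cases hKK : x ∈ K ∨ y ∈ K
    · have h1 : ‖u x - u y‖ₑ ^ r / ‖x - y‖ₑ ^ (N + α * r) ≤
          ENNReal.ofReal (A ^ r) * G (x - y) := by
        rw [← ofReal_norm, ← ofReal_norm, ENNReal.ofReal_rpow_of_nonneg (norm_nonneg _) hr0.le,
          ENNReal.ofReal_rpow_of_pos h0,
          ← ENNReal.ofReal_div_of_pos (Real.rpow_pos_of_pos h0 _), hG,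
          ← ENNReal.ofReal_mul (by positivity)]
        apply ENNReal.ofReal_le_ofReal
        rw [← mul_div_assoc, ← Real.mul_rpow hA0 (by positivity)]
        gcongr
        exact hbound x y
      refine h1.trans ?_
      gcongr
      rcases hKK with h | h
      · simp [h]
      · simp [h]
    · push Not at hKK
      rw [image_eq_zero_of_notMem_tsupport hKK.1, image_eq_zero_of_notMem_tsupport hKK.2]
      simp [hr0]
  have hI : ∫⁻ h, G h < ∞ := lintegral_gagliardo_kernel_lt_top (r := r) hα hr hN
  have hKfin : volume K < ∞ := hc.isCompact.measure_lt_top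
  rw [gagliardo]
  refine ENNReal.rpow_lt_top_of_nonneg (by positivity) (ne_of_lt ?_)
  simp only [Measure.restrict_univ]
  have hind : Measurable (K.indicator (1 : EuclideanSpace ℝ (Fin N) → ℝ≥0∞)) :=
    measurable_one.indicator hKm
  have e1 : ∫⁻ x, ∫⁻ y, K.indicator 1 x * G (x - y) = volume K * ∫⁻ h, G h := by
    have : ∀ x, ∫⁻ y, K.indicator 1 x * G (x - y) = K.indicator 1 x * ∫⁻ h, G h := fun x => by
      rw [lintegral_const_mul _ (by fun_prop), lintegral_sub_left_eq_self]
    simp_rw [this]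
    rw [lintegral_mul_const _ hind, lintegral_indicator_one hKm]
  have e2 : ∫⁻ x, ∫⁻ y, K.indicator 1 y * G (x - y) = volume K * ∫⁻ h, G h := by
    rw [lintegral_lintegral_swap (Measurable.aemeasurable (by
      unfold Function.uncurry; fun_prop))]
    simp_rw [hGneg]
    exact e1
  calc ∫⁻ x, ∫⁻ y, ‖u x - u y‖ₑ ^ r / ‖x - y‖ₑ ^ (N + α * r)
      ≤ ∫⁻ x, ∫⁻ y, ENNReal.ofReal (A ^ r) *
        (K.indicator 1 x * G (x - y) + K.indicator 1 y * G (x - y)) :=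
        lintegral_mono fun x => lintegral_mono fun y => hpt x y
    _ = ∫⁻ x, ENNReal.ofReal (A ^ r) *
        ((∫⁻ y, K.indicator 1 x * G (x - y)) + ∫⁻ y, K.indicator 1 y * G (x - y)) := by
        refine lintegral_congr fun x => ?_
        rw [lintegral_const_mul _ (by fun_prop), lintegral_add_left (by fun_prop)]
    _ = ENNReal.ofReal (A ^ r) * ((volume K * ∫⁻ h, G h) + (volume K * ∫⁻ h, G h)) := by
        have m1 : Measurable fun x => ∫⁻ y, K.indicator 1 x * G (x - y) :=
          Measurable.lintegral_prod_right' (f := fun z : EuclideanSpace ℝ (Fin N) ×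
            EuclideanSpace ℝ (Fin N) => K.indicator 1 z.1 * G (z.1 - z.2)) (by fun_prop)
        have m2 : Measurable fun x => ∫⁻ y, K.indicator 1 y * G (x - y) :=
          Measurable.lintegral_prod_right' (f := fun z : EuclideanSpace ℝ (Fin N) ×
            EuclideanSpace ℝ (Fin N) => K.indicator 1 z.2 * G (z.1 - z.2)) (by fun_prop)
        rw [lintegral_const_mul _ (by exact m1.add m2), lintegral_add_left m1, e1, e2]
    _ < ∞ := by
        have := ENNReal.mul_lt_top hKfin hI
        exact ENNReal.mul_lt_top ENNReal.ofReal_lt_top (ENNReal.add_lt_top.2 ⟨this, this⟩)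

end Auxiliary

/-- The space `C_c^∞(Ω)`, as a carrier for the norm `φ ↦ [φ]_{W^{α,r}(ℝ^N)}` (and not for the
topology of test functions). The parameters enter only through this norm. -/
@[nolint unusedArguments]
def SlobodeckiiTest {N : ℕ} (Ω : Opens (EuclideanSpace ℝ (Fin N))) {α r : ℝ}
    (_hα : α ∈ Ioo (0 : ℝ) 1) (_hr : 1 ≤ r) : Type :=
  𝓓(Ω, ℝ)

namespace SlobodeckiiTest

variable {N : ℕ} {Ω : Opens (EuclideanSpace ℝ (Fin N))} {α r : ℝ}
  {hα : α ∈ Ioo (0 : ℝ) 1} {hr : 1 ≤ r}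

noncomputable instance : AddCommGroup (SlobodeckiiTest Ω hα hr) := inferInstanceAs (AddCommGroup 𝓓(Ω, ℝ))

noncomputable instance : Module ℝ (SlobodeckiiTest Ω hα hr) := inferInstanceAs (Module ℝ 𝓓(Ω, ℝ))

/-- The identity map from test functions to test functions with the norm `[·]_{W^{α,r}(ℝ^N)}`. -/
noncomputable def of (hα : α ∈ Ioo (0 : ℝ) 1) (hr : 1 ≤ r) : 𝓓(Ω, ℝ) ≃ₗ[ℝ] SlobodeckiiTest Ω hα hr :=
  LinearEquiv.refl ℝ 𝓓(Ω, ℝ)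

theorem gagliardo_ne_top (hα : α ∈ Ioo (0 : ℝ) 1) (hr : 1 ≤ r) (φ : 𝓓(Ω, ℝ)) :
    gagliardo univ α r φ ≠ ∞ :=
  (gagliardo_univ_lt_top hα hr (φ.contDiff.of_le (by exact_mod_cast le_top))
    φ.hasCompactSupport).ne

/-- The seminorm `[φ]_{W^{α,r}(ℝ^N)}` on test functions. -/
noncomputable def seminorm (Ω : Opens (EuclideanSpace ℝ (Fin N))) (hα : α ∈ Ioo (0 : ℝ) 1)
    (hr : 1 ≤ r) : Seminorm ℝ (SlobodeckiiTest Ω hα hr) :=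
  Seminorm.of (fun φ => (gagliardo univ α r ((of hα hr).symm φ)).toReal)
    (fun φ ψ => by
      rw [← ENNReal.toReal_add (gagliardo_ne_top hα hr _) (gagliardo_ne_top hα hr _)]
      refine ENNReal.toReal_mono (ENNReal.add_ne_top.2
        ⟨gagliardo_ne_top hα hr _, gagliardo_ne_top hα hr _⟩) ?_
      exact gagliardo_univ_add_le α hr ((of hα hr).symm φ).continuous
        ((of hα hr).symm ψ).continuous)
    (fun c φ => by
      have h := gagliardo_univ_smul α hr ((of hα hr).symm φ).continuous c
      rw [← toReal_enorm c, ← ENNReal.toReal_mul, ← h]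
      rfl)

noncomputable instance : SeminormedAddCommGroup (SlobodeckiiTest Ω hα hr) :=
  (seminorm Ω hα hr).toAddGroupSeminorm.toSeminormedAddCommGroup

noncomputable instance : NormedSpace ℝ (SlobodeckiiTest Ω hα hr) where
  norm_smul_le c φ := (map_smul_eq_mul (seminorm Ω hα hr) c φ).le

theorem norm_of (φ : 𝓓(Ω, ℝ)) : ‖of hα hr φ‖ = (gagliardo univ α r φ).toReal := rfl

end SlobodeckiiTest

/-- The homogeneous Sobolev-Slobodeckii space `𝒟₀^{α,r}(Ω)`: the completion of `C_c^∞(Ω)` with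
respect to the norm `φ ↦ [φ]_{W^{α,r}(ℝ^N)}`. -/
abbrev HomSlobodeckii {N : ℕ} (Ω : Opens (EuclideanSpace ℝ (Fin N))) {α r : ℝ}
    (hα : α ∈ Ioo (0 : ℝ) 1) (hr : 1 ≤ r) : Type :=
  UniformSpace.Completion (SlobodeckiiTest Ω hα hr)

/-- A test function on `Ω` as an element of `𝒟₀^{α,r}(Ω)`. -/
noncomputable def HomSlobodeckii.ofTest {N : ℕ} {Ω : Opens (EuclideanSpace ℝ (Fin N))} {α r : ℝ}
    (hα : α ∈ Ioo (0 : ℝ) 1) (hr : 1 ≤ r) (φ : 𝓓(Ω, ℝ)) : HomSlobodeckii Ω hα hr :=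
  ((SlobodeckiiTest.of hα hr φ : SlobodeckiiTest Ω hα hr) : HomSlobodeckii Ω hα hr)

theorem one_sub_mem_Ioo {β : ℝ} (hβ : β ∈ Ioo (0 : ℝ) 1) : 1 - β ∈ Ioo (0 : ℝ) 1 :=
  ⟨by linarith [hβ.2], by linarith [hβ.1]⟩

theorem one_le_conjExponent {q : ℝ} (hq : 1 < q) : 1 ≤ q.conjExponent :=
  (Real.HolderConjugate.conjExponent hq).symm.lt.le

/-- The space `𝒟^{β-1,q}(Ω)`: the topological dual of `𝒟₀^{1-β,q'}(Ω)`, `q' = q / (q - 1)`,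
with the dual norm. -/
abbrev NegSlobodeckii {N : ℕ} (Ω : Opens (EuclideanSpace ℝ (Fin N))) {β q : ℝ}
    (hβ : β ∈ Ioo (0 : ℝ) 1) (hq : 1 < q) : Type :=
  StrongDual ℝ (HomSlobodeckii Ω (one_sub_mem_Ioo hβ) (one_le_conjExponent hq))

/-- An element `F` of `𝒟^{β-1,q}(Ω)` is the distribution `T` on `Ω` if both have the same values
on test functions. As test functions are dense in `𝒟₀^{1-β,q'}(Ω)`, there is at most one such `F`
for every `T`. -/
def NegSlobodeckii.IsDistribution {N : ℕ} {Ω : Opens (EuclideanSpace ℝ (Fin N))} {β q : ℝ}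
    {hβ : β ∈ Ioo (0 : ℝ) 1} {hq : 1 < q} (F : NegSlobodeckii Ω hβ hq) (T : 𝓓'(Ω, ℝ)) : Prop :=
  ∀ φ : 𝓓(Ω, ℝ),
    F (HomSlobodeckii.ofTest (one_sub_mem_Ioo hβ) (one_le_conjExponent hq) φ) = T φ

/-- The distribution `φ ↦ ∫_Ω φ f` on `Ω` given by a function `f` that is locally integrable
on `Ω`. -/
noncomputable def distributionOfFun {N : ℕ} (Ω : Opens (EuclideanSpace ℝ (Fin N)))
    (f : EuclideanSpace ℝ (Fin N) → ℝ) : 𝓓'(Ω, ℝ) :=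
  (TestFunction.integralAgainstBilinCLM (ContinuousLinearMap.mul ℝ ℝ) volume f : 𝓓(Ω, ℝ) →L[ℝ] ℝ)

/-- The open ball of center `x₀` and radius `R`, as an open set. -/
def openBall {N : ℕ} (x₀ : EuclideanSpace ℝ (Fin N)) (R : ℝ) :
    Opens (EuclideanSpace ℝ (Fin N)) :=
  ⟨Metric.ball x₀ R, Metric.isOpen_ball⟩

/-! By density of test functions everything reduces to `|∫_B f ∂_v φ| ≤ C [f]_{W^{β,q}(B)}
[φ]_{W^{1-β,q'}(ℝ^N)}` for `φ ∈ C_c^∞(B)`. The derivative is shared between the two factors scale by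
scale, and `f` is never extended beyond `B` in a way that uses its regularity there.

Let `f_t` be the mollification of `f` at scale `t`, let `φ_t` be the mollification of `φ` followed
by a slight contraction towards the centre (`inwardReg`), and set `F(t) = ∫ f_t ∂_v φ_t`
(`regPairing`). The contraction keeps `φ_t` supported in `B(x₀, R - t)`, where `f_t` depends only on
the values of `f` in `B`. Integration by parts gives `F(t) - F(t/2) = ∫ (f_t - f_{t/2}) ∂_v φ_t - ∫
∂_v f_{t/2} (φ_t - φ_{t/2})`. Differences of mollifications are bounded by the averaged oscillation
`oscAvg` at scale `t`, and derivatives by `t⁻¹` times it, so each step costs at most a constant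
times `t⁻¹ ∫_B osc_t f · osc_t φ` (`enorm_regPairing_sub_le`). The coarsest term `F(R/2)` obeys the
same bound, because `φ` vanishes outside `B` (`enorm_regPairing_half_le`).

Writing `t⁻¹ = t^{-β} t^{-(1-β)}` and applying Hölder in `x` and then over the scales `t = T/2^k`
leaves `∑_k ∫ (t^{-α} osc_t g)^p` for each factor. Jensen and a geometric sum bound this by the
Gagliardo seminorm (`sum_lintegral_oscAvg_rpow_le`). Finally `F(T/2^k) → ∫ f ∂_v φ`
(`tendsto_regPairing`). -/

/-! ### Averaged oscillations and their dyadic sums. -/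

section Oscillation

variable {N : ℕ}

/-- The averaged oscillation `t^{-N} ∫_{Ω ∩ B(x, 8t)} |g(z) - g(x)| dz`. -/
noncomputable def oscAvg (Ω : Set (EuclideanSpace ℝ (Fin N))) (t : ℝ)
    (g : EuclideanSpace ℝ (Fin N) → ℝ) (x : EuclideanSpace ℝ (Fin N)) : ℝ≥0∞ :=
  ENNReal.ofReal (t ^ N)⁻¹ * ∫⁻ z in Ω ∩ Metric.ball x (8 * t), ‖g z - g x‖ₑ

/-- Trades a domain moving with `x` for an integrand on a fixed domain, so that Tonelli and joint
measurability apply. -/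
theorem setLIntegral_inter_ball_eq (Ω : Set (EuclideanSpace ℝ (Fin N))) (r : ℝ)
    (h : EuclideanSpace ℝ (Fin N) → ℝ≥0∞) (x : EuclideanSpace ℝ (Fin N)) :
    ∫⁻ z in Ω ∩ Metric.ball x r, h z = ∫⁻ z in Ω, if dist z x < r then h z else 0 := by
  have : (fun z => if dist z x < r then h z else 0) = (Metric.ball x r).indicator h := by
    ext z
    simp [indicator, Metric.mem_ball]
  rw [this, lintegral_indicator measurableSet_ball, Measure.restrict_restrict measurableSet_ball,
    inter_comm]

theorem measurable_setLIntegral_ite {Ω : Set (EuclideanSpace ℝ (Fin N))} (r p : ℝ)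
    {g : EuclideanSpace ℝ (Fin N) → ℝ} (hg : Measurable g) :
    Measurable fun x => ∫⁻ z in Ω, if dist z x < r then ‖g z - g x‖ₑ ^ p else 0 := by
  refine Measurable.lintegral_prod_right' (f := fun w : EuclideanSpace ℝ (Fin N) ×
    EuclideanSpace ℝ (Fin N) => if dist w.2 w.1 < r then ‖g w.2 - g w.1‖ₑ ^ p else 0) ?_
  refine Measurable.ite ?_ (by fun_prop) measurable_const
  exact measurableSet_lt (by fun_prop) measurable_const

theorem measurable_oscAvg {Ω : Set (EuclideanSpace ℝ (Fin N))} (t : ℝ)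
    {g : EuclideanSpace ℝ (Fin N) → ℝ} (hg : Measurable g) : Measurable (oscAvg Ω t g) := by
  unfold oscAvg
  simp_rw [setLIntegral_inter_ball_eq]
  have := measurable_setLIntegral_ite (Ω := Ω) (8 * t) 1 hg
  simp only [ENNReal.rpow_one] at this
  exact this.const_mul _

/-- Hölder against the constant function `1`. -/
theorem lintegral_rpow_le_measure_mul {α : Type*} [MeasurableSpace α] (μ : Measure α) {p : ℝ}
    (hp : 1 < p) {h : α → ℝ≥0∞} (hh : AEMeasurable h μ) :
    (∫⁻ x, h x ∂μ) ^ p ≤ μ univ ^ (p - 1) * ∫⁻ x, h x ^ p ∂μ := by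
  have hpq := Real.HolderConjugate.conjExponent hp
  have h1 := ENNReal.lintegral_mul_le_Lp_mul_Lq μ hpq hh (g := fun _ => 1) aemeasurable_const
  simp only [Pi.mul_apply, mul_one, ENNReal.one_rpow, lintegral_const, one_mul] at h1
  calc (∫⁻ x, h x ∂μ) ^ p
      ≤ ((∫⁻ x, h x ^ p ∂μ) ^ (1 / p) * μ univ ^ (1 / p.conjExponent)) ^ p := by
        gcongr
    _ = _ := by
        rw [ENNReal.mul_rpow_of_nonneg _ _ hpq.nonneg, ← ENNReal.rpow_mul, ← ENNReal.rpow_mul,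
          one_div_mul_cancel hpq.ne_zero, ENNReal.rpow_one, mul_comm]
        congr 2
        rw [Real.conjExponent]
        field_simp

/-- Jensen for an average: the ball has measure `8^N t^N |B_1|`, and its power `p - 1` absorbs all
but one factor of the normalization `t^{-N}` raised to `p`. -/
theorem oscAvg_rpow_le {Ω : Set (EuclideanSpace ℝ (Fin N))} {t p : ℝ} (ht : 0 < t) (hp : 1 < p)
    {g : EuclideanSpace ℝ (Fin N) → ℝ} (hg : Measurable g) (x : EuclideanSpace ℝ (Fin N)) :
    oscAvg Ω t g x ^ p ≤
      (ENNReal.ofReal (8 ^ N) * volume (Metric.ball (0 : EuclideanSpace ℝ (Fin N)) 1)) ^ (p - 1) *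
      (ENNReal.ofReal (t ^ N)⁻¹ * ∫⁻ z in Ω ∩ Metric.ball x (8 * t), ‖g z - g x‖ₑ ^ p) := by
  have htN : 0 < t ^ N := by positivity
  set a := ENNReal.ofReal (t ^ N)⁻¹ with ha
  have ha0 : a ≠ 0 := by simpa [ha] using htN
  have hv : volume (Ω ∩ Metric.ball x (8 * t)) ≤
      ENNReal.ofReal (t ^ N) * (ENNReal.ofReal (8 ^ N) *
        volume (Metric.ball (0 : EuclideanSpace ℝ (Fin N)) 1)) := by
    refine (measure_mono inter_subset_right).trans (le_of_eq ?_)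
    rw [Measure.addHaar_ball_of_pos _ _ (by positivity), ← mul_assoc, ← ENNReal.ofReal_mul htN.le]
    congr 2
    rw [finrank_euclideanSpace_fin, mul_pow, mul_comm]
  have h1 := lintegral_rpow_le_measure_mul (volume.restrict (Ω ∩ Metric.ball x (8 * t))) hp
    (h := fun z => ‖g z - g x‖ₑ) (by fun_prop)
  rw [Measure.restrict_apply_univ] at h1
  have hp1 : 0 ≤ p - 1 := by linarith
  have haa : a ^ p * ENNReal.ofReal (t ^ N) ^ (p - 1) = a := by
    have hb : ENNReal.ofReal (t ^ N) = a⁻¹ := by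
      rw [ha, ← ENNReal.ofReal_inv_of_pos (by positivity), inv_inv]
    rw [hb, ENNReal.inv_rpow, ← ENNReal.rpow_neg, ← ENNReal.rpow_add _ _ ha0 (by simp [ha])]
    simp
  rw [oscAvg, ENNReal.mul_rpow_of_nonneg _ _ (by linarith)]
  calc a ^ p * (∫⁻ z in Ω ∩ Metric.ball x (8 * t), ‖g z - g x‖ₑ) ^ p
      ≤ a ^ p * ((ENNReal.ofReal (t ^ N) * (ENNReal.ofReal (8 ^ N) *
        volume (Metric.ball (0 : EuclideanSpace ℝ (Fin N)) 1))) ^ (p - 1) *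
        ∫⁻ z in Ω ∩ Metric.ball x (8 * t), ‖g z - g x‖ₑ ^ p) := by
        gcongr
        exact h1.trans (by gcongr)
    _ = (a ^ p * ENNReal.ofReal (t ^ N) ^ (p - 1)) * (ENNReal.ofReal (8 ^ N) *
        volume (Metric.ball (0 : EuclideanSpace ℝ (Fin N)) 1)) ^ (p - 1) *
        ∫⁻ z in Ω ∩ Metric.ball x (8 * t), ‖g z - g x‖ₑ ^ p := by
        rw [ENNReal.mul_rpow_of_nonneg _ _ hp1]
        ring
    _ = _ := by
        rw [haa]
        ring

/-- A geometric sum of ratio `2^s ≥ 2` is at most its first omitted term. -/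
theorem sum_dyadic_rpow_le {T s : ℝ} (hT : 0 < T) (hs : 1 ≤ s) (n : ℕ) :
    ∑ k ∈ Finset.range n, (T / 2 ^ k) ^ (-s) ≤ (T / 2 ^ n) ^ (-s) := by
  induction n with
  | zero => simp; positivity
  | succ n ih =>
    rw [Finset.sum_range_succ]
    have h1 : (T / 2 ^ (n + 1)) ^ (-s) = 2 ^ s * (T / 2 ^ n) ^ (-s) := by
      rw [pow_succ, ← div_div, Real.div_rpow (by positivity) (by norm_num),
        Real.rpow_neg (by norm_num : (0 : ℝ) ≤ 2)]
      field_simp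
    have h2 : (2 : ℝ) ≤ 2 ^ s := Real.self_le_rpow_of_one_le (by norm_num) hs
    have h3 : 0 ≤ (T / 2 ^ n) ^ (-s) := by positivity
    rw [h1]
    nlinarith

/-- Two points at distance `r` are compared only at scales with `r < 8t`. The finest such scale
dominates the geometric sum, whence the factor `2`, and there `t^{-s} ≤ 8^s r^{-s}`. -/
theorem sum_dyadic_ite_le {T s r : ℝ} (hT : 0 < T) (hs : 1 ≤ s) (hr : 0 < r) (n : ℕ) :
    ∑ k ∈ Finset.range n, (if r < 8 * (T / 2 ^ k) then (T / 2 ^ k) ^ (-s) else 0) ≤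
      2 * 8 ^ s * r ^ (-s) := by
  induction n with
  | zero => simp; positivity
  | succ n ih =>
    rw [Finset.sum_range_succ]
    split_ifs with h
    · have h1 : ∑ k ∈ Finset.range n, (if r < 8 * (T / 2 ^ k) then (T / 2 ^ k) ^ (-s) else 0) ≤
          ∑ k ∈ Finset.range n, (T / 2 ^ k) ^ (-s) := by
        refine Finset.sum_le_sum fun k _ => ?_
        split_ifs
        · rfl
        · positivity
      have h2 := sum_dyadic_rpow_le hT hs n
      have h3 : (T / 2 ^ n) ^ (-s) ≤ 8 ^ s * r ^ (-s) := by
        have h4 : (8 * (T / 2 ^ n)) ^ (-s) ≤ r ^ (-s) :=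
          Real.rpow_le_rpow_of_nonpos hr h.le (by linarith)
        rw [Real.mul_rpow (by norm_num) (by positivity)] at h4
        calc (T / 2 ^ n) ^ (-s) = 8 ^ s * (8 ^ (-s) * (T / 2 ^ n) ^ (-s)) := by
              rw [← mul_assoc, ← Real.rpow_add (by norm_num)]
              simp
          _ ≤ _ := by gcongr
      linarith
    · simpa using ih

/-- Summing the averaged oscillations over the dyadic scales `T / 2^k` is controlled by the
Gagliardo seminorm. -/
theorem sum_lintegral_oscAvg_rpow_le {Ω : Set (EuclideanSpace ℝ (Fin N))} {T p α : ℝ}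
    (hT : 0 < T) (hp : 1 < p) (hα : 0 < α) (hN : N ≠ 0)
    {g : EuclideanSpace ℝ (Fin N) → ℝ} (hg : Measurable g) (n : ℕ) :
    ∑ k ∈ Finset.range n, ∫⁻ x in Ω,
        (ENNReal.ofReal ((T / 2 ^ k) ^ (-α)) * oscAvg Ω (T / 2 ^ k) g x) ^ p ≤
      (ENNReal.ofReal (8 ^ N) * volume (Metric.ball (0 : EuclideanSpace ℝ (Fin N)) 1)) ^ (p - 1) *
      ENNReal.ofReal (2 * 8 ^ (N + α * p)) * gagliardo Ω α p g ^ p := by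
  have hp0 : 0 < p := by linarith
  set V := (ENNReal.ofReal (8 ^ N) * volume (Metric.ball (0 : EuclideanSpace ℝ (Fin N)) 1)) ^ (p - 1)
    with hV
  set s : ℝ := N + α * p with hs
  have hs1 : 1 ≤ s := by
    have : (1 : ℝ) ≤ N := by exact_mod_cast Nat.one_le_iff_ne_zero.2 hN
    have := mul_pos hα hp0
    linarith
  have hG : gagliardo Ω α p g ^ p =
      ∫⁻ x in Ω, ∫⁻ z in Ω, ‖g x - g z‖ₑ ^ p / ‖x - z‖ₑ ^ s := by
    rw [gagliardo, ← ENNReal.rpow_mul, one_div_mul_cancel hp0.ne', ENNReal.rpow_one]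
  -- The weight `t^{-αp}` and the normalization `t^{-N}` combine to `t^{-s}`, the order of the
  -- Gagliardo kernel; summing `H k` over `k` then recovers that kernel pointwise.
  set H : ℕ → EuclideanSpace ℝ (Fin N) → EuclideanSpace ℝ (Fin N) → ℝ≥0∞ := fun k x z =>
    ENNReal.ofReal ((T / 2 ^ k) ^ (-s)) *
      (if dist z x < 8 * (T / 2 ^ k) then ‖g z - g x‖ₑ ^ p else 0) with hH
  have hHm : ∀ k, Measurable (Function.uncurry (H k)) := fun k => by
    refine Measurable.const_mul (Measurable.ite ?_ (by fun_prop) measurable_const) _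
    exact measurableSet_lt (by fun_prop) measurable_const
  have step1 : ∀ k x, (ENNReal.ofReal ((T / 2 ^ k) ^ (-α)) * oscAvg Ω (T / 2 ^ k) g x) ^ p ≤
      V * ∫⁻ z in Ω, H k x z := fun k x => by
    have ht : 0 < T / 2 ^ k := by positivity
    rw [ENNReal.mul_rpow_of_nonneg _ _ hp0.le]
    refine (mul_le_mul_right (oscAvg_rpow_le ht hp hg x) _).trans (le_of_eq ?_)
    rw [setLIntegral_inter_ball_eq, lintegral_const_mul' _ _ ENNReal.ofReal_ne_top, mul_left_comm,
      ← mul_assoc (ENNReal.ofReal _ ^ p)]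
    congr 2
    rw [ENNReal.ofReal_rpow_of_nonneg (by positivity) hp0.le, ← ENNReal.ofReal_mul (by positivity),
      ← Real.rpow_mul ht.le, ← Real.rpow_natCast (T / 2 ^ k) N, ← Real.rpow_neg ht.le, ← Real.rpow_add ht]
    congr 2
    rw [hs]
    ring
  have step2 : ∀ x z, ∑ k ∈ Finset.range n, H k x z ≤
      ENNReal.ofReal (2 * 8 ^ s) * (‖g x - g z‖ₑ ^ p / ‖x - z‖ₑ ^ s) := fun x z => by
    by_cases hxz : x = z
    · subst hxz
      simp [hH, hp0]
    have hr : 0 < ‖x - z‖ := norm_pos_iff.2 (sub_ne_zero.2 hxz)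
    have h1 : ∀ k, H k x z = ENNReal.ofReal
        (if ‖x - z‖ < 8 * (T / 2 ^ k) then (T / 2 ^ k) ^ (-s) else 0) * ‖g x - g z‖ₑ ^ p :=
      fun k => by
        have e : ‖g z - g x‖ₑ = ‖g x - g z‖ₑ := by rw [← enorm_neg, neg_sub]
        simp only [hH, dist_comm z x, dist_eq_norm x z, e]
        split_ifs <;> simp
    simp_rw [h1]
    rw [← Finset.sum_mul, ← ENNReal.ofReal_sum_of_nonneg (fun k _ => by split_ifs <;> positivity)]
    refine (mul_le_mul_left (ENNReal.ofReal_le_ofReal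
      (sum_dyadic_ite_le hT hs1 hr n)) _).trans (le_of_eq ?_)
    rw [ENNReal.ofReal_mul (by positivity), mul_assoc, ENNReal.div_eq_inv_mul,
      Real.rpow_neg hr.le, ENNReal.ofReal_inv_of_pos (by positivity),
      ← ENNReal.ofReal_rpow_of_pos hr, ofReal_norm]
  calc _ ≤ ∑ k ∈ Finset.range n, ∫⁻ x in Ω, V * ∫⁻ z in Ω, H k x z :=
        Finset.sum_le_sum fun k _ => lintegral_mono fun x => step1 k x
    _ = ∫⁻ x in Ω, V * ∫⁻ z in Ω, ∑ k ∈ Finset.range n, H k x z := by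
        rw [← lintegral_finsetSum]
        · refine lintegral_congr fun x => ?_
          rw [lintegral_finsetSum _ fun k _ => (hHm k).of_uncurry_left, Finset.mul_sum]
        · exact fun k _ => ((hHm k).lintegral_prod_right').const_mul _
    _ ≤ ∫⁻ x in Ω, V * ∫⁻ z in Ω, ENNReal.ofReal (2 * 8 ^ s) *
          (‖g x - g z‖ₑ ^ p / ‖x - z‖ₑ ^ s) := by
        gcongr with x z
        exact step2 x z
    _ = _ := by
        have hm : Measurable fun x => ∫⁻ z in Ω, ‖g x - g z‖ₑ ^ p / ‖x - z‖ₑ ^ s :=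
          Measurable.lintegral_prod_right' (f := fun w : EuclideanSpace ℝ (Fin N) ×
            EuclideanSpace ℝ (Fin N) => ‖g w.1 - g w.2‖ₑ ^ p / ‖w.1 - w.2‖ₑ ^ s) (by fun_prop)
        simp_rw [lintegral_const_mul' _ _ ENNReal.ofReal_ne_top, ← mul_assoc]
        rw [lintegral_const_mul _ hm, hG]

end Oscillation

/-! ### Mollification controlled by oscillation. -/

section Mollifier

open scoped Convolution
open ContinuousLinearMap (mul)

variable {N : ℕ}

/-- A nonnegative `C¹` function of integral one, supported in the ball of radius `t`, with the
natural bounds on its values and on its derivative. -/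
structure IsMollifier (η : EuclideanSpace ℝ (Fin N) → ℝ) (M t : ℝ) : Prop where
  contDiff : ContDiff ℝ 1 η
  tsupport_subset : tsupport η ⊆ Metric.ball 0 t
  nonneg : ∀ y, 0 ≤ η y
  integral_eq_one : ∫ y, η y = 1
  norm_le : ∀ y, ‖η y‖ ≤ M * (t ^ N)⁻¹
  norm_fderiv_le : ∀ y, ‖fderiv ℝ η y‖ ≤ M * t⁻¹ * (t ^ N)⁻¹

theorem exists_isMollifier (N : ℕ) : ∃ M : ℝ, 0 < M ∧ ∀ t : ℝ, 0 < t →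
    ∃ η : EuclideanSpace ℝ (Fin N) → ℝ, IsMollifier η M t := by
  -- Outer radius `1/2` puts the closure of the rescaled support in the closed ball of radius `t/2`,
  -- hence inside the open ball of radius `t`.
  let b : ContDiffBump (0 : EuclideanSpace ℝ (Fin N)) := ⟨1 / 4, 1 / 2, by norm_num, by norm_num⟩
  set ρ := b.normed volume with hρ
  have hc : HasCompactSupport ρ := b.hasCompactSupport_normed
  have hd : ContDiff ℝ 1 ρ := b.contDiff_normed (n := 1)
  obtain ⟨M₁, hM₁⟩ := hd.continuous.bounded_above_of_compact_support hc
  obtain ⟨M₂, hM₂⟩ := (hd.continuous_fderiv one_ne_zero).bounded_above_of_compact_support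
    (hc.fderiv ℝ)
  refine ⟨max 1 (max M₁ M₂), by positivity, fun t ht => ⟨fun y => (t ^ N)⁻¹ * ρ (t⁻¹ • y), ?_⟩⟩
  have htN : 0 < t ^ N := by positivity
  refine ⟨by fun_prop, ?_, fun y => ?_, ?_, fun y => ?_, fun y => ?_⟩
  · refine (closure_minimal (t := Metric.closedBall 0 (t / 2)) (fun y hy => ?_)
      Metric.isClosed_closedBall).trans (Metric.closedBall_subset_ball (by linarith))
    have hy' : t⁻¹ • y ∈ Function.support ρ := fun h => hy (by simp [h])
    rw [hρ, b.support_normed_eq, mem_ball_zero_iff, norm_smul, norm_inv, Real.norm_of_nonneg ht.le,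
      inv_mul_lt_iff₀ ht] at hy'
    rw [mem_closedBall_zero_iff]
    exact hy'.le.trans (le_of_eq (by simp [b]; ring))
  · exact mul_nonneg (by positivity) (b.nonneg_normed _)
  · rw [integral_const_mul, Measure.integral_comp_inv_smul_of_nonneg _ _ ht.le, hρ,
      b.integral_normed, finrank_euclideanSpace_fin, smul_eq_mul, mul_one,
      inv_mul_cancel₀ htN.ne']
  · rw [norm_mul, norm_inv, Real.norm_of_nonneg htN.le, mul_comm]
    gcongr
    exact (hM₁ _).trans ((le_max_left _ _).trans (le_max_right _ _))
  · have h1 : HasFDerivAt (fun y => (t ^ N)⁻¹ * ρ (t⁻¹ • y))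
        ((t ^ N)⁻¹ • (fderiv ℝ ρ (t⁻¹ • y)).comp
          (t⁻¹ • ContinuousLinearMap.id ℝ (EuclideanSpace ℝ (Fin N)))) y := by
      have h2 : HasFDerivAt (fun y : EuclideanSpace ℝ (Fin N) => t⁻¹ • y)
          (t⁻¹ • ContinuousLinearMap.id ℝ (EuclideanSpace ℝ (Fin N))) y :=
        (hasFDerivAt_id y).const_smul t⁻¹
      have h3 := (hd.differentiable one_ne_zero (t⁻¹ • y)).hasFDerivAt.comp y h2
      exact h3.const_mul _
    rw [h1.fderiv, norm_smul, norm_inv, Real.norm_of_nonneg htN.le, mul_comm]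
    gcongr
    rw [ContinuousLinearMap.comp_smul, norm_smul, norm_inv, Real.norm_of_nonneg ht.le, mul_comm]
    gcongr
    rw [ContinuousLinearMap.comp_id]
    exact (hM₂ _).trans ((le_max_right _ _).trans (le_max_right _ _))

namespace IsMollifier

variable {η η₁ η₂ g : EuclideanSpace ℝ (Fin N) → ℝ} {M t t₁ t₂ : ℝ}

theorem hasCompactSupport (h : IsMollifier η M t) : HasCompactSupport η :=
  HasCompactSupport.of_support_subset_isCompact (isCompact_closedBall 0 t)
    ((subset_tsupport η).trans (h.tsupport_subset.trans Metric.ball_subset_closedBall))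

theorem mem_ball_of_ne_zero (h : IsMollifier η M t) {y z : EuclideanSpace ℝ (Fin N)}
    (hz : η (y - z) ≠ 0) : z ∈ Metric.ball y t := by
  have := h.tsupport_subset (subset_tsupport η hz)
  rwa [mem_ball_zero_iff, ← dist_eq_norm, dist_comm] at this

theorem mem_ball_of_fderiv_ne_zero (h : IsMollifier η M t) {y z v : EuclideanSpace ℝ (Fin N)}
    (hz : fderiv ℝ η (y - z) v ≠ 0) : z ∈ Metric.ball y t := by
  have h1 : fderiv ℝ η (y - z) ≠ 0 := fun h0 => hz (by simp [h0])
  have := h.tsupport_subset (support_fderiv_subset ℝ h1)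
  rwa [mem_ball_zero_iff, ← dist_eq_norm, dist_comm] at this

theorem pos (h : IsMollifier η M t) : 0 < t := by
  by_contra ht
  have h1 : ∀ y, η y = 0 := fun y => by
    by_contra hy
    have := h.tsupport_subset (subset_tsupport η hy)
    rw [Metric.ball_eq_empty.2 (not_lt.1 ht)] at this
    exact this
  simpa [h1] using h.integral_eq_one

theorem integrable_comp_sub (h : IsMollifier η M t) (y : EuclideanSpace ℝ (Fin N)) :
    Integrable fun z => η (y - z) :=
  (h.contDiff.continuous.integrable_of_hasCompactSupport h.hasCompactSupport).comp_sub_left y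

theorem hasCompactSupport_fderiv (h : IsMollifier η M t) (v : EuclideanSpace ℝ (Fin N)) :
    HasCompactSupport fun y => fderiv ℝ η y v :=
  h.hasCompactSupport.fderiv_apply ℝ v

theorem continuous_fderiv_apply (h : IsMollifier η M t) (v : EuclideanSpace ℝ (Fin N)) :
    Continuous fun y => fderiv ℝ η y v :=
  (h.contDiff.continuous_fderiv one_ne_zero).clm_apply continuous_const

theorem integrable_fderiv_comp_sub (h : IsMollifier η M t) (y v : EuclideanSpace ℝ (Fin N)) :
    Integrable fun z => fderiv ℝ η (y - z) v :=
  ((h.continuous_fderiv_apply v).integrable_of_hasCompactSupport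
    (h.hasCompactSupport_fderiv v)).comp_sub_left y

theorem integral_comp_sub (h : IsMollifier η M t) (y : EuclideanSpace ℝ (Fin N)) :
    ∫ z, η (y - z) = 1 := by
  rw [integral_sub_left_eq_self (fun z => η z), h.integral_eq_one]

/-- Integration by parts against the constant `1`. Thus the derivative of a mollification ignores
constants, and `g x` may be subtracted from `g` under the integral. -/
theorem integral_fderiv_comp_sub (h : IsMollifier η M t) (y v : EuclideanSpace ℝ (Fin N)) :
    ∫ z, fderiv ℝ η (y - z) v = 0 := by
  rw [integral_sub_left_eq_self (fun z => fderiv ℝ η z v)]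
  have hi := h.contDiff.continuous.integrable_of_hasCompactSupport (μ := volume) h.hasCompactSupport
  have hi' := (h.continuous_fderiv_apply v).integrable_of_hasCompactSupport (μ := volume)
    (h.hasCompactSupport_fderiv v)
  have h1 := integral_mul_fderiv_eq_neg_fderiv_mul_of_integrable (μ := volume)
    (f := fun _ : EuclideanSpace ℝ (Fin N) => (1 : ℝ)) (g := η) (v := v) (by simp)
    (by simpa using hi') (by simpa using hi)
    (fun _ _ => by fun_prop) (fun x _ => h.contDiff.differentiable one_ne_zero x)
  simpa using h1

theorem integrable_mul_comp_sub (h : IsMollifier η M t) (hg : LocallyIntegrable g)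
    (y : EuclideanSpace ℝ (Fin N)) : Integrable fun z => g z * η (y - z) :=
  h.hasCompactSupport.convolutionExists_right (mul ℝ ℝ) hg h.contDiff.continuous y

theorem integrable_mul_fderiv_comp_sub (h : IsMollifier η M t) (hg : LocallyIntegrable g)
    (y v : EuclideanSpace ℝ (Fin N)) : Integrable fun z => g z * fderiv ℝ η (y - z) v :=
  (h.hasCompactSupport_fderiv v).convolutionExists_right (mul ℝ ℝ) hg
    (h.continuous_fderiv_apply v) y

theorem contDiff_convolution (h : IsMollifier η M t) (hg : LocallyIntegrable g) :
    ContDiff ℝ 1 (g ⋆[mul ℝ ℝ, volume] η) :=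
  h.hasCompactSupport.contDiff_convolution_right (n := 1) (mul ℝ ℝ) hg h.contDiff

theorem fderiv_convolution (h : IsMollifier η M t) (hg : LocallyIntegrable g)
    (y v : EuclideanSpace ℝ (Fin N)) :
    fderiv ℝ (g ⋆[mul ℝ ℝ, volume] η) y v = ∫ z, g z * fderiv ℝ η (y - z) v := by
  rw [(h.hasCompactSupport.hasFDerivAt_convolution_right (mul ℝ ℝ) hg h.contDiff y).fderiv,
    convolution_precompR_apply _ hg (h.hasCompactSupport.fderiv ℝ)
      (h.contDiff.continuous_fderiv one_ne_zero)]
  rfl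

/-- Places the derivative on `g` instead of `η`: this gives bounds uniform in the scale and the
pointwise limit for smooth `g`. -/
theorem fderiv_convolution_of_contDiff (h : IsMollifier η M t) (hg : ContDiff ℝ 1 g)
    (hgc : HasCompactSupport g) (y v : EuclideanSpace ℝ (Fin N)) :
    fderiv ℝ (g ⋆[mul ℝ ℝ, volume] η) y v = (η ⋆[.lsmul ℝ ℝ, volume] fun z => fderiv ℝ g z v) y := by
  have h1 : (g ⋆[mul ℝ ℝ, volume] η) = (η ⋆[mul ℝ ℝ, volume] g) := by
    ext x
    rw [convolution_mul_swap, convolution_mul]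
    simp_rw [mul_comm]
  have hη := h.contDiff.continuous.locallyIntegrable (μ := volume)
  rw [h1, (hgc.hasFDerivAt_convolution_right (mul ℝ ℝ) hη hg y).fderiv,
    convolution_precompR_apply _ hη (hgc.fderiv ℝ) (hg.continuous_fderiv one_ne_zero)]
  rfl

end IsMollifier

/-- Common source of the pointwise bounds below: `K` will be a translated mollifier or its
derivative, the latter with `t⁻¹` inside `m`. -/
theorem enorm_integral_mul_le_oscAvg {Ω : Set (EuclideanSpace ℝ (Fin N))}
    {g K : EuclideanSpace ℝ (Fin N) → ℝ} {t m : ℝ} {x : EuclideanSpace ℝ (Fin N)} (hm : 0 ≤ m)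
    (hΩ : MeasurableSet Ω) (hsupp : ∀ z, K z ≠ 0 → z ∈ Ω ∩ Metric.ball x (8 * t)) (hK : ∀ z, ‖K z‖ ≤ m * (t ^ N)⁻¹) :
    ‖∫ z, (g z - g x) * K z‖ₑ ≤ ENNReal.ofReal m * oscAvg Ω t g x := by
  have hS : MeasurableSet (Ω ∩ Metric.ball x (8 * t)) := hΩ.inter measurableSet_ball
  have h1 : ∫ z, (g z - g x) * K z = ∫ z in Ω ∩ Metric.ball x (8 * t), (g z - g x) * K z := by
    rw [setIntegral_eq_integral_of_forall_compl_eq_zero]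
    intro z hz
    by_contra h0
    exact hz (hsupp z (right_ne_zero_of_mul h0))
  rw [h1, oscAvg, ← mul_assoc, ← ENNReal.ofReal_mul hm,
    ← lintegral_const_mul' _ _ ENNReal.ofReal_ne_top]
  refine (enorm_integral_le_lintegral_enorm _).trans (lintegral_mono fun z => ?_)
  rw [enorm_mul, mul_comm]
  gcongr
  rw [← ofReal_norm]
  exact ENNReal.ofReal_le_ofReal (hK z)

/-- Lets mollifiers of both scales `t` and `t/2` be measured by the oscillation at the single scale
`t`. -/
theorem inv_pow_le_two_pow_mul {t t₁ : ℝ} (ht : 0 < t) (h : t ≤ 2 * t₁) :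
    (t₁ ^ N)⁻¹ ≤ 2 ^ N * (t ^ N)⁻¹ := by
  have h1 : 0 < t₁ := by linarith
  rw [← div_eq_mul_inv, inv_le_comm₀ (by positivity) (by positivity), inv_div,
    div_le_iff₀ (by positivity), ← mul_pow, mul_comm]
  gcongr

namespace IsMollifier

variable {η η₁ η₂ g : EuclideanSpace ℝ (Fin N) → ℝ} {M t t₁ t₂ : ℝ}
  {Ω : Set (EuclideanSpace ℝ (Fin N))} {x y y₁ y₂ v : EuclideanSpace ℝ (Fin N)}

/-- As `η` has integral one, the left side averages `g z - g x`. The centre `y` need not be `x`,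
which leaves room for the dilation. -/
theorem enorm_convolution_sub_self_le (h : IsMollifier η M t₁) (hM : 0 ≤ M) (ht : 0 < t)
    (ht₁ : t ≤ 2 * t₁) (hg : LocallyIntegrable g) (hΩ : MeasurableSet Ω)
    (hy : Metric.ball y t₁ ⊆ Ω ∩ Metric.ball x (8 * t)) :
    ‖(g ⋆[mul ℝ ℝ, volume] η) y - g x‖ₑ ≤ ENNReal.ofReal (M * 2 ^ N) * oscAvg Ω t g x := by
  have hi1 := h.integrable_mul_comp_sub hg y
  have hi2 := (h.integrable_comp_sub y).const_mul (g x)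
  have e : (g ⋆[mul ℝ ℝ, volume] η) y - g x = ∫ z, (g z - g x) * η (y - z) := by
    simp_rw [sub_mul]
    rw [integral_sub hi1 hi2, integral_const_mul, h.integral_comp_sub, mul_one, convolution_mul]
  rw [e]
  refine enorm_integral_mul_le_oscAvg (by positivity) hΩ
    (fun z hz => hy (h.mem_ball_of_ne_zero hz)) (fun z => (h.norm_le _).trans ?_)
  rw [mul_assoc]
  gcongr
  exact inv_pow_le_two_pow_mul ht ht₁

theorem enorm_convolution_sub_convolution_le (h₁ : IsMollifier η₁ M t₁)
    (h₂ : IsMollifier η₂ M t₂) (hM : 0 ≤ M) (ht : 0 < t)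
    (ht₁ : t ≤ 2 * t₁) (ht₂ : t ≤ 2 * t₂) (hg : LocallyIntegrable g) (hΩ : MeasurableSet Ω)
    (hy₁ : Metric.ball y₁ t₁ ⊆ Ω ∩ Metric.ball x (8 * t))
    (hy₂ : Metric.ball y₂ t₂ ⊆ Ω ∩ Metric.ball x (8 * t)) :
    ‖(g ⋆[mul ℝ ℝ, volume] η₁) y₁ - (g ⋆[mul ℝ ℝ, volume] η₂) y₂‖ₑ ≤
      ENNReal.ofReal (M * 2 ^ (N + 1)) * oscAvg Ω t g x := by
  have e : (g ⋆[mul ℝ ℝ, volume] η₁) y₁ - (g ⋆[mul ℝ ℝ, volume] η₂) y₂ =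
      ((g ⋆[mul ℝ ℝ, volume] η₁) y₁ - g x) - ((g ⋆[mul ℝ ℝ, volume] η₂) y₂ - g x) := by ring
  rw [e]
  refine enorm_sub_le.trans ((add_le_add (h₁.enorm_convolution_sub_self_le hM ht ht₁ hg hΩ hy₁)
    (h₂.enorm_convolution_sub_self_le hM ht ht₂ hg hΩ hy₂)).trans (le_of_eq ?_))
  rw [← add_mul, ← ENNReal.ofReal_add (by positivity) (by positivity)]
  congr 2
  ring

theorem enorm_fderiv_convolution_le (h : IsMollifier η M t₁) (hM : 0 ≤ M) (ht : 0 < t)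
    (ht₁ : t ≤ 2 * t₁) (hg : LocallyIntegrable g) (hΩ : MeasurableSet Ω)
    (hy : Metric.ball y t₁ ⊆ Ω ∩ Metric.ball x (8 * t)) (hv : ‖v‖ ≤ 1) :
    ‖fderiv ℝ (g ⋆[mul ℝ ℝ, volume] η) y v‖ₑ ≤
      ENNReal.ofReal (M * 2 ^ (N + 1) * t⁻¹) * oscAvg Ω t g x := by
  have hi1 := h.integrable_mul_fderiv_comp_sub hg y v
  have hi2 := (h.integrable_fderiv_comp_sub y v).const_mul (g x)
  have e : fderiv ℝ (g ⋆[mul ℝ ℝ, volume] η) y v = ∫ z, (g z - g x) * fderiv ℝ η (y - z) v := by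
    simp_rw [sub_mul]
    rw [integral_sub hi1 hi2, integral_const_mul, h.integral_fderiv_comp_sub, mul_zero, sub_zero,
      h.fderiv_convolution hg]
  rw [e]
  refine enorm_integral_mul_le_oscAvg (by positivity) hΩ
    (fun z hz => hy (h.mem_ball_of_fderiv_ne_zero hz)) (fun z => ?_)
  have h1 := (fderiv ℝ η (y - z)).le_of_opNorm_le_of_le (h.norm_fderiv_le _) hv
  have h2 : t₁⁻¹ ≤ 2 * t⁻¹ := by simpa using inv_pow_le_two_pow_mul (N := 1) ht ht₁
  have h3 : (t₁ ^ N)⁻¹ ≤ 2 ^ N * (t ^ N)⁻¹ := inv_pow_le_two_pow_mul ht ht₁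
  have := h.pos
  calc ‖fderiv ℝ η (y - z) v‖ ≤ M * t₁⁻¹ * (t₁ ^ N)⁻¹ * 1 := h1
    _ ≤ M * (2 * t⁻¹) * (2 ^ N * (t ^ N)⁻¹) * 1 := by gcongr
    _ = _ := by ring

end IsMollifier

end Mollifier

/-! ### Hölder's inequality across scales, and vanishing of the oscillation. -/

section OscillationHolder

variable {N : ℕ}

/-- The constant in the bound of the dyadic sum of oscillations by the Gagliardo seminorm. -/
noncomputable def oscConst (N : ℕ) (α p : ℝ) : ℝ≥0∞ :=
  ((ENNReal.ofReal (8 ^ N) * volume (Metric.ball (0 : EuclideanSpace ℝ (Fin N)) 1)) ^ (p - 1) *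
    ENNReal.ofReal (2 * 8 ^ (N + α * p))) ^ (1 / p)

theorem oscConst_ne_top (N : ℕ) (α : ℝ) {p : ℝ} (hp : 1 < p) : oscConst N α p ≠ ∞ := by
  refine ENNReal.rpow_ne_top_of_nonneg (by positivity) (ENNReal.mul_ne_top ?_ ENNReal.ofReal_ne_top)
  exact ENNReal.rpow_ne_top_of_nonneg (by linarith)
    (ENNReal.mul_ne_top ENNReal.ofReal_ne_top measure_ball_lt_top.ne)

theorem sum_lintegral_oscAvg_rpow_rpow_le {Ω : Set (EuclideanSpace ℝ (Fin N))} {T p α : ℝ}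
    (hT : 0 < T) (hp : 1 < p) (hα : 0 < α) (hN : N ≠ 0)
    {g : EuclideanSpace ℝ (Fin N) → ℝ} (hg : Measurable g) (n : ℕ) :
    (∑ k ∈ Finset.range n, ∫⁻ x in Ω,
        (ENNReal.ofReal ((T / 2 ^ k) ^ (-α)) * oscAvg Ω (T / 2 ^ k) g x) ^ p) ^ (1 / p) ≤
      oscConst N α p * gagliardo Ω α p g := by
  have hp0 : 0 < p := by linarith
  refine (ENNReal.rpow_le_rpow (sum_lintegral_oscAvg_rpow_le hT hp hα hN hg n)
    (by positivity)).trans (le_of_eq ?_)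
  rw [ENNReal.mul_rpow_of_nonneg _ _ (by positivity), oscConst, ← ENNReal.rpow_mul _ p,
    mul_one_div_cancel hp0.ne', ENNReal.rpow_one]

/-- Since `α + α' = 1`, the factor `t⁻¹` splits as `t^{-α} t^{-α'}`. Hölder is used in `x` at each
scale and then for the sum over scales. -/
theorem sum_lintegral_oscAvg_mul_le {Ω : Set (EuclideanSpace ℝ (Fin N))} {T p p' α α' : ℝ}
    (hT : 0 < T) (hp : p.HolderConjugate p') (hα : 0 < α) (hα' : 0 < α') (hαα' : α + α' = 1)
    (hN : N ≠ 0) {f g : EuclideanSpace ℝ (Fin N) → ℝ} (hf : Measurable f) (hg : Measurable g)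
    (n : ℕ) :
    ∑ k ∈ Finset.range n, ENNReal.ofReal (T / 2 ^ k)⁻¹ *
        ∫⁻ x in Ω, oscAvg Ω (T / 2 ^ k) f x * oscAvg univ (T / 2 ^ k) g x ≤
      oscConst N α p * oscConst N α' p' * (gagliardo Ω α p f * gagliardo univ α' p' g) := by
  set a : ℕ → ℝ≥0∞ := fun k => ∫⁻ x in Ω,
    (ENNReal.ofReal ((T / 2 ^ k) ^ (-α)) * oscAvg Ω (T / 2 ^ k) f x) ^ p
  set b : ℕ → ℝ≥0∞ := fun k => ∫⁻ x in univ,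
    (ENNReal.ofReal ((T / 2 ^ k) ^ (-α')) * oscAvg univ (T / 2 ^ k) g x) ^ p'
  have h1 : ∀ k, ENNReal.ofReal (T / 2 ^ k)⁻¹ *
      ∫⁻ x in Ω, oscAvg Ω (T / 2 ^ k) f x * oscAvg univ (T / 2 ^ k) g x ≤
      a k ^ (1 / p) * b k ^ (1 / p') := fun k => by
    have ht : 0 < T / 2 ^ k := by positivity
    have e : ENNReal.ofReal (T / 2 ^ k)⁻¹ =
        ENNReal.ofReal ((T / 2 ^ k) ^ (-α)) * ENNReal.ofReal ((T / 2 ^ k) ^ (-α')) := by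
      rw [← ENNReal.ofReal_mul (by positivity), ← Real.rpow_add ht, ← neg_add, hαα',
        Real.rpow_neg_one]
    have hol := ENNReal.lintegral_mul_le_Lp_mul_Lq (volume.restrict Ω) hp
      (((measurable_oscAvg (Ω := Ω) (T / 2 ^ k) hf).const_mul
        (ENNReal.ofReal ((T / 2 ^ k) ^ (-α)))).aemeasurable)
      (((measurable_oscAvg (Ω := univ) (T / 2 ^ k) hg).const_mul
        (ENNReal.ofReal ((T / 2 ^ k) ^ (-α')))).aemeasurable)
    rw [← lintegral_const_mul' _ _ ENNReal.ofReal_ne_top]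
    refine le_trans (lintegral_mono fun x => le_of_eq ?_) (hol.trans ?_)
    · simp only [Pi.mul_apply]
      rw [e]
      ring
    · gcongr
      · exact one_div_nonneg.2 hp.symm.nonneg
      · exact lintegral_mono_set (subset_univ _)
  have hp0 := hp.nonneg
  calc _ ≤ ∑ k ∈ Finset.range n, a k ^ (1 / p) * b k ^ (1 / p') :=
        Finset.sum_le_sum fun k _ => h1 k
    _ ≤ (∑ k ∈ Finset.range n, a k) ^ (1 / p) * (∑ k ∈ Finset.range n, b k) ^ (1 / p') := by
        refine (ENNReal.inner_le_Lp_mul_Lq _ _ _ hp).trans (le_of_eq ?_)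
        simp_rw [← ENNReal.rpow_mul, one_div_mul_cancel hp.ne_zero,
          one_div_mul_cancel hp.symm.ne_zero, ENNReal.rpow_one]
    _ ≤ (oscConst N α p * gagliardo Ω α p f) * (oscConst N α' p' * gagliardo univ α' p' g) :=
        mul_le_mul' (sum_lintegral_oscAvg_rpow_rpow_le hT hp.lt hα hN hf n)
          (sum_lintegral_oscAvg_rpow_rpow_le hT hp.symm.lt hα' hN hg n)
    _ = _ := by ring

/-- A single term of the bounded dyadic sum already gives an `L^p` norm of order `t^α`; finite
measure turns this into an `L^1` bound. -/
theorem tendsto_lintegral_oscAvg_zero {Ω : Set (EuclideanSpace ℝ (Fin N))} {T p α : ℝ}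
    (hT : 0 < T) (hp : 1 < p) (hα : 0 < α) (hN : N ≠ 0) (hΩ : volume Ω ≠ ∞)
    {f : EuclideanSpace ℝ (Fin N) → ℝ} (hf : Measurable f) (hfG : gagliardo Ω α p f ≠ ∞) :
    Filter.Tendsto (fun k : ℕ => ∫⁻ x in Ω, oscAvg Ω (T / 2 ^ k) f x) Filter.atTop (nhds 0) := by
  have hp0 : 0 < p := by linarith
  set A := volume Ω ^ ((p - 1) / p) * (oscConst N α p * gagliardo Ω α p f) with hA
  have hAtop : A ≠ ∞ := ENNReal.mul_ne_top
    (ENNReal.rpow_ne_top_of_nonneg (div_nonneg (by linarith) hp0.le) hΩ)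
    (ENNReal.mul_ne_top (oscConst_ne_top N α hp) hfG)
  have hbound : ∀ k : ℕ, ∫⁻ x in Ω, oscAvg Ω (T / 2 ^ k) f x ≤
      ENNReal.ofReal ((T / 2 ^ k) ^ α) * A := fun k => by
    have ht : 0 < T / 2 ^ k := by positivity
    have h1 : (∫⁻ x in Ω, (ENNReal.ofReal ((T / 2 ^ k) ^ (-α)) * oscAvg Ω (T / 2 ^ k) f x) ^ p) ^
        (1 / p) ≤ oscConst N α p * gagliardo Ω α p f := by
      refine le_trans ?_ (sum_lintegral_oscAvg_rpow_rpow_le hT hp hα hN hf (k + 1))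
      gcongr
      exact Finset.single_le_sum (f := fun k => ∫⁻ x in Ω,
        (ENNReal.ofReal ((T / 2 ^ k) ^ (-α)) * oscAvg Ω (T / 2 ^ k) f x) ^ p)
        (fun _ _ => zero_le) (Finset.self_mem_range_succ k)
    have h2 := lintegral_rpow_le_measure_mul (volume.restrict Ω) hp
      (((measurable_oscAvg (Ω := Ω) (T / 2 ^ k) hf).const_mul
        (ENNReal.ofReal ((T / 2 ^ k) ^ (-α)))).aemeasurable)
    rw [Measure.restrict_apply_univ, lintegral_const_mul' _ _ ENNReal.ofReal_ne_top] at h2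
    have h3 := ENNReal.rpow_le_rpow h2 (by positivity : 0 ≤ 1 / p)
    rw [← ENNReal.rpow_mul, mul_one_div_cancel hp0.ne', ENNReal.rpow_one,
      ENNReal.mul_rpow_of_nonneg _ _ (by positivity), ← ENNReal.rpow_mul, mul_one_div] at h3
    have h4 := h3.trans (mul_le_mul_right h1 _)
    calc ∫⁻ x in Ω, oscAvg Ω (T / 2 ^ k) f x
        = ENNReal.ofReal ((T / 2 ^ k) ^ α) * (ENNReal.ofReal ((T / 2 ^ k) ^ (-α)) *
          ∫⁻ x in Ω, oscAvg Ω (T / 2 ^ k) f x) := by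
          rw [← mul_assoc, ← ENNReal.ofReal_mul (by positivity), ← Real.rpow_add ht]
          simp
      _ ≤ _ := by gcongr
  have hlim : Filter.Tendsto (fun k : ℕ => ENNReal.ofReal ((T / 2 ^ k) ^ α) * A) Filter.atTop
      (nhds 0) := by
    have h1 : Filter.Tendsto (fun k : ℕ => T / 2 ^ k) Filter.atTop (nhds 0) :=
      tendsto_const_nhds.div_atTop (tendsto_pow_atTop_atTop_of_one_lt one_lt_two)
    have h2 := h1.rpow_const (p := α) (Or.inr hα.le)
    rw [Real.zero_rpow hα.ne'] at h2
    have h3 := ENNReal.Tendsto.mul_const (ENNReal.tendsto_ofReal h2) (Or.inr hAtop)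
    simpa using h3
  exact tendsto_of_tendsto_of_tendsto_of_le_of_le tendsto_const_nhds hlim (fun _ => zero_le) hbound

end OscillationHolder

/-! ### Inward regularization and the pairing at one scale. -/

section InwardRegularization

open scoped Convolution
open ContinuousLinearMap (mul)

variable {N : ℕ}

/-- Mollification of `φ` followed by a dilation towards `x₀`; if `φ` is supported in `B(x₀, R)` and
`η` in `B(0, t)` with `2 t ≤ R`, the result is supported in `B(x₀, R - t)`. -/
noncomputable def inwardReg (x₀ : EuclideanSpace ℝ (Fin N)) (R t : ℝ)
    (φ η : EuclideanSpace ℝ (Fin N) → ℝ) (x : EuclideanSpace ℝ (Fin N)) : ℝ :=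
  (φ ⋆[mul ℝ ℝ, volume] η) (x₀ + (1 + 4 * (t / R)) • (x - x₀))

variable {x₀ v x : EuclideanSpace ℝ (Fin N)} {R t M : ℝ}
  {φ η η' f : EuclideanSpace ℝ (Fin N) → ℝ}

theorem contDiff_inwardReg (h : IsMollifier η M t) (hφ : Continuous φ) :
    ContDiff ℝ 1 (inwardReg x₀ R t φ η) :=
  (h.contDiff_convolution hφ.locallyIntegrable).comp (by fun_prop)

theorem fderiv_inwardReg (h : IsMollifier η M t) (hφ : Continuous φ)
    (x v : EuclideanSpace ℝ (Fin N)) :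
    fderiv ℝ (inwardReg x₀ R t φ η) x v = (1 + 4 * (t / R)) *
      fderiv ℝ (φ ⋆[mul ℝ ℝ, volume] η) (x₀ + (1 + 4 * (t / R)) • (x - x₀)) v := by
  set c := 1 + 4 * (t / R)
  have h1 : HasFDerivAt (fun x => x₀ + c • (x - x₀))
      (c • ContinuousLinearMap.id ℝ (EuclideanSpace ℝ (Fin N))) x :=
    (((hasFDerivAt_id x).sub_const x₀).const_smul c).const_add x₀
  have h2 := ((h.contDiff_convolution hφ.locallyIntegrable).differentiable one_ne_zero
    (x₀ + c • (x - x₀))).hasFDerivAt.comp x h1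
  have h3 : fderiv ℝ (inwardReg x₀ R t φ η) x = _ := h2.fderiv
  rw [h3]
  simp

/-- Mollifying enlarges the support to radius `R + t`, and dividing by `1 + 4t/R` must bring it to
`R - t`. Indeed `(1 + 4t/R)(R - t) = R + 3t - 4t²/R ≥ R + t` exactly when `2t ≤ R`. -/
theorem support_inwardReg_subset (h : IsMollifier η M t) (hR : 2 * t ≤ R)
    (hsupp : Function.support φ ⊆ Metric.ball x₀ R) :
    Function.support (inwardReg x₀ R t φ η) ⊆ Metric.ball x₀ (R - t) := by
  intro x hx
  have ht := h.pos
  have hR0 : 0 < R := by linarith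
  obtain ⟨z, hz⟩ : ∃ z, φ z * η (x₀ + (1 + 4 * (t / R)) • (x - x₀) - z) ≠ 0 := by
    by_contra! h0
    exact hx (by simp [inwardReg, convolution_mul, h0])
  have h1 := hsupp (left_ne_zero_of_mul hz)
  have h2 := h.mem_ball_of_ne_zero (right_ne_zero_of_mul hz)
  rw [Metric.mem_ball] at h1 h2 ⊢
  have h3 := dist_triangle_left (x₀ + (1 + 4 * (t / R)) • (x - x₀)) x₀ z
  rw [dist_self_add_left, norm_smul, Real.norm_of_nonneg (by positivity), ← dist_eq_norm] at h3
  have h4 : (1 + 4 * (t / R)) * dist x x₀ < t + R := by linarith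
  have h5 : t + R ≤ (1 + 4 * (t / R)) * (R - t) := by
    have : (1 + 4 * (t / R)) * (R - t) = R + 3 * t - 4 * t * (t / R) := by
      field_simp
      ring
    have h6 : t / R ≤ 1 / 2 := by
      rw [div_le_iff₀ hR0]
      linarith
    nlinarith
  exact lt_of_mul_lt_mul_left (h4.trans_le h5) (by positivity)

theorem tsupport_inwardReg_subset (h : IsMollifier η M t) (hR : 2 * t ≤ R)
    (hsupp : Function.support φ ⊆ Metric.ball x₀ R) :
    tsupport (inwardReg x₀ R t φ η) ⊆ Metric.closedBall x₀ (R - t) :=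
  closure_minimal ((support_inwardReg_subset h hR hsupp).trans Metric.ball_subset_closedBall)
    Metric.isClosed_closedBall

theorem hasCompactSupport_inwardReg (h : IsMollifier η M t) (hR : 2 * t ≤ R)
    (hsupp : Function.support φ ⊆ Metric.ball x₀ R) :
    HasCompactSupport (inwardReg x₀ R t φ η) :=
  HasCompactSupport.of_support_subset_isCompact (isCompact_closedBall x₀ (R - t))
    ((subset_tsupport _).trans (tsupport_inwardReg_subset h hR hsupp))

theorem inwardReg_eq_zero (h : IsMollifier η M t) (hR : 2 * t ≤ R)
    (hsupp : Function.support φ ⊆ Metric.ball x₀ R) (hx : x ∉ Metric.closedBall x₀ (R - t)) :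
    inwardReg x₀ R t φ η x = 0 :=
  image_eq_zero_of_notMem_tsupport fun hx' => hx (tsupport_inwardReg_subset h hR hsupp hx')

theorem fderiv_inwardReg_eq_zero (h : IsMollifier η M t) (hR : 2 * t ≤ R)
    (hsupp : Function.support φ ⊆ Metric.ball x₀ R) (hx : x ∉ Metric.closedBall x₀ (R - t)) :
    fderiv ℝ (inwardReg x₀ R t φ η) x = 0 := by
  by_contra h0
  exact hx (tsupport_inwardReg_subset h hR hsupp (support_fderiv_subset ℝ h0))

/-- On the support of the inward regularization, mollifying `f` uses only its values in `B(x₀, R)`.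
-/
theorem ball_subset_inter_of_mem_closedBall {r s : ℝ} (hr : r ≤ 8 * s)
    (hx : x ∈ Metric.closedBall x₀ (R - r)) :
    Metric.ball x r ⊆ Metric.ball x₀ R ∩ Metric.ball x (8 * s) := by
  refine subset_inter (Metric.ball_subset_ball' ?_) (Metric.ball_subset_ball hr)
  rw [Metric.mem_closedBall] at hx
  linarith

/-- The dilation moves a point of the ball by at most `4t`, and mollifying reaches `t` further. -/
theorem ball_dilation_subset {s : ℝ} (ht : 0 < t) (hR : 0 < R) (hs : 5 * t ≤ 8 * s)
    (hx : x ∈ Metric.closedBall x₀ R) :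
    Metric.ball (x₀ + (1 + 4 * (t / R)) • (x - x₀)) t ⊆ univ ∩ Metric.ball x (8 * s) := by
  rw [univ_inter]
  refine Metric.ball_subset_ball' ?_
  have e : x₀ + (1 + 4 * (t / R)) • (x - x₀) - x = (4 * (t / R)) • (x - x₀) := by
    module
  rw [dist_eq_norm, e, norm_smul, Real.norm_of_nonneg (by positivity), ← dist_eq_norm]
  rw [Metric.mem_closedBall] at hx
  have : 4 * (t / R) * dist x x₀ ≤ 4 * (t / R) * R := by gcongr
  have e2 : 4 * (t / R) * R = 4 * t := by field_simp
  linarith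

theorem enorm_fderiv_inwardReg_le (h : IsMollifier η M t) (hM : 0 ≤ M) (hR : 2 * t ≤ R)
    (hφ : Continuous φ) (hx : x ∈ Metric.closedBall x₀ R) (hv : ‖v‖ ≤ 1) :
    ‖fderiv ℝ (inwardReg x₀ R t φ η) x v‖ₑ ≤
      ENNReal.ofReal (3 * (M * 2 ^ (N + 1) * t⁻¹)) * oscAvg univ t φ x := by
  have ht := h.pos
  have hR0 : 0 < R := by linarith
  have h6 : t / R ≤ 1 / 2 := by
    rw [div_le_iff₀ hR0]
    linarith
  rw [fderiv_inwardReg h hφ, enorm_mul, ENNReal.ofReal_mul (by norm_num), mul_assoc]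
  gcongr
  · rw [Real.enorm_of_nonneg (by positivity)]
    exact ENNReal.ofReal_le_ofReal (by linarith)
  · exact h.enorm_fderiv_convolution_le hM ht (by linarith) hφ.locallyIntegrable
      MeasurableSet.univ (ball_dilation_subset ht hR0 (by linarith) hx) hv

theorem enorm_inwardReg_sub_le (h : IsMollifier η M t) (h' : IsMollifier η' M (t / 2))
    (hM : 0 ≤ M) (hR : 2 * t ≤ R) (hφ : Continuous φ) (hx : x ∈ Metric.closedBall x₀ R) :
    ‖inwardReg x₀ R t φ η x - inwardReg x₀ R (t / 2) φ η' x‖ₑ ≤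
      ENNReal.ofReal (M * 2 ^ (N + 1)) * oscAvg univ t φ x := by
  have ht := h.pos
  have hR0 : 0 < R := by linarith
  exact h.enorm_convolution_sub_convolution_le h' hM ht (by linarith) (by linarith)
    hφ.locallyIntegrable MeasurableSet.univ (ball_dilation_subset ht hR0 (by linarith) hx)
    (ball_dilation_subset h'.pos hR0 (by linarith) hx)

/-- Poincaré-type bound at the largest scale: `φ` vanishes on a ball outside `B(x₀, R)`. -/
theorem enorm_inwardReg_half_le (h : IsMollifier η M t) (hM : 0 ≤ M) (hR : R = 2 * t)
    (hφ : Continuous φ) (hsupp : Function.support φ ⊆ Metric.ball x₀ R)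
    (hx : x ∈ Metric.closedBall x₀ R) (hN : N ≠ 0) :
    ‖inwardReg x₀ R t φ η x‖ₑ ≤ ENNReal.ofReal (M * 2 ^ (N + 1)) * oscAvg univ t φ x := by
  have ht := h.pos
  have hR0 : 0 < R := by linarith
  -- At distance `2R` from `x₀` the ball `B(p, t)` misses `B(x₀, R)`, so the mollified `φ` vanishes
  -- at `p`. It lies in `B(x, 8t)` because `3R + t = 7t`; this is what the radius `8t` in `oscAvg`
  -- has to accommodate.
  set p : EuclideanSpace ℝ (Fin N) :=
    x₀ + (2 * R) • EuclideanSpace.single ⟨0, Nat.pos_of_ne_zero hN⟩ (1 : ℝ) with hp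
  have hpd : dist p x₀ = 2 * R := by
    rw [hp, dist_self_add_left, norm_smul, Real.norm_of_nonneg (by positivity)]
    simp
  have h0 : (φ ⋆[mul ℝ ℝ, volume] η) p = 0 := by
    rw [convolution_mul]
    refine integral_eq_zero_of_ae (Filter.Eventually.of_forall fun z => ?_)
    by_contra hz
    have h1 := hsupp (left_ne_zero_of_mul hz)
    have h2 := h.mem_ball_of_ne_zero (right_ne_zero_of_mul hz)
    rw [Metric.mem_ball] at h1 h2
    have h3 := dist_triangle_left p x₀ z
    linarith
  have h1 := h.enorm_convolution_sub_convolution_le (y₂ := p) h hM ht (by linarith) (by linarith)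
    hφ.locallyIntegrable MeasurableSet.univ (ball_dilation_subset (s := t) ht hR0 (by linarith) hx) (by
      rw [univ_inter]
      refine Metric.ball_subset_ball' ?_
      rw [Metric.mem_closedBall] at hx
      have := dist_triangle_right p x x₀
      linarith)
  rwa [h0, sub_zero] at h1

theorem integral_mul_fderiv_eq_neg {u w : EuclideanSpace ℝ (Fin N) → ℝ} (hu : ContDiff ℝ 1 u)
    (hw : ContDiff ℝ 1 w) (hc : HasCompactSupport w) (v : EuclideanSpace ℝ (Fin N)) :
    ∫ x, u x * fderiv ℝ w x v = -∫ x, fderiv ℝ u x v * w x := by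
  have hu' : Continuous fun x => fderiv ℝ u x v :=
    (hu.continuous_fderiv one_ne_zero).clm_apply continuous_const
  have hw' : Continuous fun x => fderiv ℝ w x v :=
    (hw.continuous_fderiv one_ne_zero).clm_apply continuous_const
  refine integral_mul_fderiv_eq_neg_fderiv_mul_of_integrable ?_ ?_ ?_
    (fun x _ => hu.differentiable one_ne_zero x) (fun x _ => hw.differentiable one_ne_zero x)
  · exact (hu'.mul hw.continuous).integrable_of_hasCompactSupport hc.mul_left
  · exact (hu.continuous.mul hw').integrable_of_hasCompactSupport (hc.fderiv_apply ℝ v).mul_left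
  · exact (hu.continuous.mul hw.continuous).integrable_of_hasCompactSupport hc.mul_left

theorem enorm_integral_le_of_forall_mem {h : EuclideanSpace ℝ (Fin N) → ℝ}
    {H : EuclideanSpace ℝ (Fin N) → ℝ≥0∞} {S : Set (EuclideanSpace ℝ (Fin N))}
    (hS : MeasurableSet S) (h0 : ∀ x ∉ S, h x = 0) (hH : ∀ x ∈ S, ‖h x‖ₑ ≤ H x) :
    ‖∫ x, h x‖ₑ ≤ ∫⁻ x in S, H x := by
  rw [← setIntegral_eq_integral_of_forall_compl_eq_zero h0]
  exact (enorm_integral_le_lintegral_enorm _).trans (setLIntegral_mono' hS hH)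

/-- The pairing of the regularizations of `f` and of `∂_v φ`. -/
noncomputable def regPairing (x₀ v : EuclideanSpace ℝ (Fin N)) (R t : ℝ)
    (f φ η : EuclideanSpace ℝ (Fin N) → ℝ) : ℝ :=
  ∫ x, (f ⋆[mul ℝ ℝ, volume] η) x * fderiv ℝ (inwardReg x₀ R t φ η) x v

theorem closedBall_sub_subset_ball (ht : 0 < t) :
    Metric.closedBall x₀ (R - t) ⊆ Metric.ball x₀ R :=
  Metric.closedBall_subset_ball (by linarith)

/-- The derivative is moved onto the mollified `f`, which is not itself controlled by oscillation;
the regularized `φ` is, at this scale, by the Poincaré-type bound. -/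
theorem enorm_regPairing_half_le (h : IsMollifier η M t) (hM : 0 ≤ M) (hR : R = 2 * t)
    (hf : LocallyIntegrable f) (hφ : Continuous φ)
    (hsupp : Function.support φ ⊆ Metric.ball x₀ R) (hv : ‖v‖ ≤ 1) (hN : N ≠ 0) :
    ‖regPairing x₀ v R t f φ η‖ₑ ≤ ENNReal.ofReal ((M * 2 ^ (N + 1)) ^ 2) *
      (ENNReal.ofReal t⁻¹ *
        ∫⁻ x in Metric.ball x₀ R, oscAvg (Metric.ball x₀ R) t f x * oscAvg univ t φ x) := by
  have ht := h.pos
  rw [regPairing, integral_mul_fderiv_eq_neg (h.contDiff_convolution hf)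
    (contDiff_inwardReg h hφ) (hasCompactSupport_inwardReg h hR.ge hsupp), enorm_neg, ← mul_assoc,
    ← ENNReal.ofReal_mul (by positivity), ← lintegral_const_mul' _ _ ENNReal.ofReal_ne_top]
  refine (enorm_integral_le_of_forall_mem (S := Metric.closedBall x₀ (R - t))
    Metric.isClosed_closedBall.measurableSet
    (fun x hx => by rw [inwardReg_eq_zero h hR.ge hsupp hx, mul_zero]) (fun x hx => ?_)).trans
    (lintegral_mono_set (closedBall_sub_subset_ball ht))
  have hx' : x ∈ Metric.closedBall x₀ R :=
    Metric.ball_subset_closedBall (closedBall_sub_subset_ball ht hx)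
  rw [enorm_mul]
  refine (mul_le_mul' (h.enorm_fderiv_convolution_le hM ht (by linarith) hf measurableSet_ball
    (ball_subset_inter_of_mem_closedBall (s := t) (by linarith) hx) hv)
    (enorm_inwardReg_half_le h hM hR hφ hsupp hx' hN)).trans (le_of_eq ?_)
  rw [mul_mul_mul_comm, ← ENNReal.ofReal_mul (by positivity)]
  congr 2
  ring

/-- The order of the splitting matters. The coarse mollification `u` meets only `w`, supported in
`B(x₀, R - t)`, while `w'`, which may reach `B(x₀, R - t/2)`, meets only the finer `u'`. So `f` is
never sampled outside the ball. The constant is `3 + 1`, with `3` from the dilation factor `1 + 4t/R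
≤ 3`. -/
theorem enorm_regPairing_sub_le (h : IsMollifier η M t) (h' : IsMollifier η' M (t / 2))
    (hM : 0 ≤ M) (hR : 2 * t ≤ R) (hf : LocallyIntegrable f) (hφ : Continuous φ)
    (hsupp : Function.support φ ⊆ Metric.ball x₀ R) (hv : ‖v‖ ≤ 1) :
    ‖regPairing x₀ v R t f φ η - regPairing x₀ v R (t / 2) f φ η'‖ₑ ≤
      ENNReal.ofReal (4 * (M * 2 ^ (N + 1)) ^ 2) * (ENNReal.ofReal t⁻¹ *
        ∫⁻ x in Metric.ball x₀ R, oscAvg (Metric.ball x₀ R) t f x * oscAvg univ t φ x) := by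
  have ht := h.pos
  have hR' : 2 * (t / 2) ≤ R := by linarith
  set u := f ⋆[mul ℝ ℝ, volume] η with hu
  set u' := f ⋆[mul ℝ ℝ, volume] η' with hu'
  set w := inwardReg x₀ R t φ η with hw
  set w' := inwardReg x₀ R (t / 2) φ η' with hw'
  have cu : ContDiff ℝ 1 u := h.contDiff_convolution hf
  have cu' : ContDiff ℝ 1 u' := h'.contDiff_convolution hf
  have cw : ContDiff ℝ 1 w := contDiff_inwardReg h hφ
  have cw' : ContDiff ℝ 1 w' := contDiff_inwardReg h' hφ
  have sw : HasCompactSupport w := hasCompactSupport_inwardReg h hR hsupp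
  have sw' : HasCompactSupport w' := hasCompactSupport_inwardReg h' hR' hsupp
  have int : ∀ {a b : EuclideanSpace ℝ (Fin N) → ℝ}, ContDiff ℝ 1 a → ContDiff ℝ 1 b →
      HasCompactSupport b → Integrable fun x => a x * fderiv ℝ b x v := fun ha hb hc =>
    (ha.continuous.mul ((hb.continuous_fderiv one_ne_zero).clm_apply
      continuous_const)).integrable_of_hasCompactSupport (hc.fderiv_apply ℝ v).mul_left
  have split : regPairing x₀ v R t f φ η - regPairing x₀ v R (t / 2) f φ η' =
      (∫ x, (u x - u' x) * fderiv ℝ w x v) - ∫ x, fderiv ℝ u' x v * (w x - w' x) := by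
    have e1 := integral_mul_fderiv_eq_neg cu' (cw.sub cw') (sw.sub sw') v
    rw [sub_eq_add_neg (∫ x, (u x - u' x) * fderiv ℝ w x v), ← e1]
    have e2 : ∀ x, fderiv ℝ (fun x => w x - w' x) x v =
        fderiv ℝ w x v - fderiv ℝ w' x v := fun x => by
      rw [fderiv_fun_sub (cw.differentiable one_ne_zero x) (cw'.differentiable one_ne_zero x)]
      rfl
    simp_rw [e2, mul_sub, sub_mul]
    rw [integral_sub (int cu cw sw) (int cu' cw sw), integral_sub (int cu' cw sw) (int cu' cw' sw')]
    simp only [regPairing, ← hu, ← hu', ← hw, ← hw']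
    ring
  set I := ∫⁻ x in Metric.ball x₀ R, oscAvg (Metric.ball x₀ R) t f x * oscAvg univ t φ x with hI
  have b1 : ‖∫ x, (u x - u' x) * fderiv ℝ w x v‖ₑ ≤
      ENNReal.ofReal (3 * (M * 2 ^ (N + 1)) ^ 2 * t⁻¹) * I := by
    rw [← lintegral_const_mul' _ _ ENNReal.ofReal_ne_top]
    refine (enorm_integral_le_of_forall_mem (S := Metric.closedBall x₀ (R - t))
      Metric.isClosed_closedBall.measurableSet
      (fun x hx => by simp [hw, fderiv_inwardReg_eq_zero h hR hsupp hx]) (fun x hx => ?_)).trans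
      (lintegral_mono_set (closedBall_sub_subset_ball ht))
    have hx' : x ∈ Metric.closedBall x₀ R :=
      Metric.ball_subset_closedBall (closedBall_sub_subset_ball ht hx)
    have hx2 : x ∈ Metric.closedBall x₀ (R - t / 2) :=
      Metric.closedBall_subset_closedBall (by linarith) hx
    rw [enorm_mul]
    refine (mul_le_mul' (h.enorm_convolution_sub_convolution_le h' hM ht (by linarith)
      (by linarith) hf measurableSet_ball
      (ball_subset_inter_of_mem_closedBall (s := t) (by linarith) hx)
      (ball_subset_inter_of_mem_closedBall (s := t) (by linarith) hx2))
      (enorm_fderiv_inwardReg_le h hM hR hφ hx' hv)).trans (le_of_eq ?_)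
    rw [mul_mul_mul_comm, ← ENNReal.ofReal_mul (by positivity)]
    congr 2
    ring
  have b2 : ‖∫ x, fderiv ℝ u' x v * (w x - w' x)‖ₑ ≤
      ENNReal.ofReal ((M * 2 ^ (N + 1)) ^ 2 * t⁻¹) * I := by
    rw [← lintegral_const_mul' _ _ ENNReal.ofReal_ne_top]
    refine (enorm_integral_le_of_forall_mem (S := Metric.closedBall x₀ (R - t / 2))
      Metric.isClosed_closedBall.measurableSet (fun x hx => ?_) (fun x hx => ?_)).trans
      (lintegral_mono_set (closedBall_sub_subset_ball h'.pos))
    · have hx2 : x ∉ Metric.closedBall x₀ (R - t) := fun hx2 =>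
        hx (Metric.closedBall_subset_closedBall (by linarith) hx2)
      rw [hw, hw', inwardReg_eq_zero h hR hsupp hx2, inwardReg_eq_zero h' hR' hsupp hx]
      simp
    have hx' : x ∈ Metric.closedBall x₀ R :=
      Metric.ball_subset_closedBall (closedBall_sub_subset_ball h'.pos hx)
    rw [enorm_mul]
    refine (mul_le_mul' (h'.enorm_fderiv_convolution_le hM ht (by linarith) hf measurableSet_ball
      (ball_subset_inter_of_mem_closedBall (s := t) (by linarith) hx) hv)
      (enorm_inwardReg_sub_le h h' hM hR hφ hx')).trans (le_of_eq ?_)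
    rw [mul_mul_mul_comm, ← ENNReal.ofReal_mul (by positivity)]
    congr 2
    ring
  rw [split]
  refine enorm_sub_le.trans ((add_le_add b1 b2).trans (le_of_eq ?_))
  rw [← add_mul, ← ENNReal.ofReal_add (by positivity) (by positivity), ← mul_assoc,
    ← ENNReal.ofReal_mul (by positivity)]
  congr 2
  ring

theorem norm_fderiv_convolution_le_of_norm_le (h : IsMollifier η M t) (hφ : ContDiff ℝ 1 φ)
    (hc : HasCompactSupport φ) {L : ℝ} (hL : ∀ x, ‖fderiv ℝ φ x v‖ ≤ L)
    (y : EuclideanSpace ℝ (Fin N)) : ‖fderiv ℝ (φ ⋆[mul ℝ ℝ, volume] η) y v‖ ≤ L := by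
  rw [h.fderiv_convolution_of_contDiff hφ hc, convolution_lsmul]
  have hi := h.contDiff.continuous.integrable_of_hasCompactSupport (μ := volume) h.hasCompactSupport
  refine (norm_integral_le_of_norm_le (hi.mul_const L)
    (Filter.Eventually.of_forall fun z => ?_)).trans (le_of_eq ?_)
  · rw [norm_smul, Real.norm_of_nonneg (h.nonneg z)]
    exact mul_le_mul_of_nonneg_left (hL _) (h.nonneg z)
  · rw [integral_mul_const, h.integral_eq_one, one_mul]

end InwardRegularization

/-! ### Passage to the limit and summation over scales. -/

section Limit

open scoped Convolution
open ContinuousLinearMap (mul)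

variable {N : ℕ} {x₀ v : EuclideanSpace ℝ (Fin N)} {R T M : ℝ}
  {φ f : EuclideanSpace ℝ (Fin N) → ℝ} {η : ℕ → EuclideanSpace ℝ (Fin N) → ℝ}

theorem norm_fderiv_inwardReg_le_of_norm_le {t : ℝ} {η : EuclideanSpace ℝ (Fin N) → ℝ}
    (h : IsMollifier η M t) (hR : 2 * t ≤ R) (hφ : ContDiff ℝ 1 φ)
    (hc : HasCompactSupport φ) {L : ℝ} (hL : ∀ x, ‖fderiv ℝ φ x v‖ ≤ L)
    (x : EuclideanSpace ℝ (Fin N)) : ‖fderiv ℝ (inwardReg x₀ R t φ η) x v‖ ≤ 3 * L := by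
  have ht := h.pos
  have hR0 : 0 < R := by linarith
  have h6 : t / R ≤ 1 / 2 := by
    rw [div_le_iff₀ hR0]
    linarith
  rw [fderiv_inwardReg h hφ.continuous, norm_mul, Real.norm_of_nonneg (by positivity)]
  gcongr
  · linarith
  · exact norm_fderiv_convolution_le_of_norm_le h hφ hc hL _

/-- Approximate identity evaluated at moving points: the dilation factor tends to `1`, and `∂_v φ`
is continuous. -/
theorem tendsto_fderiv_inwardReg (hη : ∀ k, IsMollifier (η k) M (T / 2 ^ k))
    (hφ : ContDiff ℝ 1 φ) (hc : HasCompactSupport φ) (x : EuclideanSpace ℝ (Fin N)) :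
    Filter.Tendsto (fun k : ℕ => fderiv ℝ (inwardReg x₀ R (T / 2 ^ k) φ (η k)) x v)
      Filter.atTop (nhds (fderiv ℝ φ x v)) := by
  have ht : Filter.Tendsto (fun k : ℕ => T / 2 ^ k) Filter.atTop (nhds 0) :=
    tendsto_const_nhds.div_atTop (tendsto_pow_atTop_atTop_of_one_lt one_lt_two)
  have hlam : Filter.Tendsto (fun k : ℕ => 1 + 4 * (T / 2 ^ k / R)) Filter.atTop (nhds 1) := by
    simpa using ((ht.div_const R).const_mul 4).const_add 1
  have hd : Continuous fun x => fderiv ℝ φ x v :=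
    (hφ.continuous_fderiv one_ne_zero).clm_apply continuous_const
  have hpt : Filter.Tendsto (fun k : ℕ => x₀ + (1 + 4 * (T / 2 ^ k / R)) • (x - x₀)) Filter.atTop
      (nhds x) := by
    simpa using (hlam.smul_const (x - x₀)).const_add x₀
  have hconv := convolution_tendsto_right (μ := volume) (l := Filter.atTop) (φ := η) (x₀ := x)
    (g := fun _ z => fderiv ℝ φ z v) (z₀ := fderiv ℝ φ x v)
    (Filter.Eventually.of_forall fun k => (hη k).nonneg)
    (Filter.Eventually.of_forall fun k => (hη k).integral_eq_one) (by
      rw [Filter.tendsto_smallSets_iff]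
      intro s hs
      obtain ⟨ε, hε, hεs⟩ := Metric.mem_nhds_iff.1 hs
      filter_upwards [ht.eventually_lt_const hε] with k hk
      exact (subset_tsupport _).trans ((hη k).tsupport_subset.trans
        ((Metric.ball_subset_ball hk.le).trans hεs)))
    (Filter.Eventually.of_forall fun k => hd.aestronglyMeasurable)
    ((hd.tendsto x).comp Filter.tendsto_snd) hpt
  have := hlam.mul hconv
  rw [one_mul] at this
  refine this.congr fun k => ?_
  rw [fderiv_inwardReg (hη k) hφ.continuous, (hη k).fderiv_convolution_of_contDiff hφ hc]

theorem tendsto_regPairing {p α : ℝ} (hT : 0 < T) (hR : R = 2 * T) (hM : 0 ≤ M) (hp : 1 < p)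
    (hα : 0 < α) (hN : N ≠ 0) (hη : ∀ k, IsMollifier (η k) M (T / 2 ^ k)) (hφ : ContDiff ℝ 1 φ)
    (hsupp : tsupport φ ⊆ Metric.ball x₀ R) (hfm : Measurable f) (hf : Integrable f)
    (hfG : gagliardo (Metric.ball x₀ R) α p f ≠ ∞) :
    Filter.Tendsto (fun k : ℕ => regPairing x₀ v R (T / 2 ^ k) f φ (η k)) Filter.atTop
      (nhds (∫ x, f x * fderiv ℝ φ x v)) := by
  have hs : Function.support φ ⊆ Metric.ball x₀ R := (subset_tsupport φ).trans hsupp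
  have hc : HasCompactSupport φ := HasCompactSupport.of_support_subset_isCompact
    (isCompact_closedBall x₀ R) (hs.trans Metric.ball_subset_closedBall)
  have hd : Continuous fun x => fderiv ℝ φ x v :=
    (hφ.continuous_fderiv one_ne_zero).clm_apply continuous_const
  obtain ⟨L, hL⟩ := hd.bounded_above_of_compact_support (hc.fderiv_apply ℝ v)
  have hL0 : 0 ≤ L := (norm_nonneg _).trans (hL 0)
  have ht : ∀ k : ℕ, 0 < T / 2 ^ k := fun k => by positivity
  have hRk : ∀ k : ℕ, 2 * (T / 2 ^ k) ≤ R := fun k => by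
    rw [hR]
    gcongr
    exact div_le_self hT.le (one_le_pow₀ one_le_two)
  set w : ℕ → EuclideanSpace ℝ (Fin N) → ℝ := fun k => inwardReg x₀ R (T / 2 ^ k) φ (η k) with hw
  set u : ℕ → EuclideanSpace ℝ (Fin N) → ℝ := fun k => f ⋆[mul ℝ ℝ, volume] η k with hu
  have cu : ∀ k, ContDiff ℝ 1 (u k) := fun k => (hη k).contDiff_convolution hf.locallyIntegrable
  have cw : ∀ k, ContDiff ℝ 1 (w k) := fun k => contDiff_inwardReg (hη k) hφ.continuous
  have cdw : ∀ k, Continuous fun x => fderiv ℝ (w k) x v := fun k =>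
    ((cw k).continuous_fderiv one_ne_zero).clm_apply continuous_const
  have sw : ∀ k, HasCompactSupport (w k) := fun k =>
    hasCompactSupport_inwardReg (hη k) (hRk k) hs
  have hbw : ∀ k x, ‖fderiv ℝ (w k) x v‖ ≤ 3 * L := fun k x =>
    norm_fderiv_inwardReg_le_of_norm_le (hη k) (hRk k) hφ hc hL x
  have i1 : ∀ k, Integrable fun x => u k x * fderiv ℝ (w k) x v := fun k =>
    ((cu k).continuous.mul (cdw k)).integrable_of_hasCompactSupport
      ((sw k).fderiv_apply ℝ v).mul_left
  have i2 : ∀ k, Integrable fun x => f x * fderiv ℝ (w k) x v := fun k =>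
    hf.mul_bdd (c := 3 * L) (cdw k).aestronglyMeasurable (Filter.Eventually.of_forall (hbw k))
  -- In the first integral `∂_v w` is bounded by `3L` and `u - f` by the oscillation, which tends to
  -- `0` in `L^1(B)`; the second converges by domination with `3L |f|`.
  have e : ∀ k, regPairing x₀ v R (T / 2 ^ k) f φ (η k) =
      (∫ x, (u k x - f x) * fderiv ℝ (w k) x v) + ∫ x, f x * fderiv ℝ (w k) x v := fun k => by
    simp_rw [sub_mul]
    rw [integral_sub (i1 k) (i2 k), sub_add_cancel]
    rfl
  simp_rw [e]
  rw [← zero_add (∫ x, f x * fderiv ℝ φ x v)]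
  refine Filter.Tendsto.add ?_ ?_
  · rw [tendsto_zero_iff_enorm_tendsto_zero]
    have h0 := ENNReal.Tendsto.const_mul
      (a := ENNReal.ofReal (M * 2 ^ N * (3 * L)))
      (tendsto_lintegral_oscAvg_zero hT hp hα hN
      (measure_ball_lt_top (x := x₀) (r := R)).ne hfm hfG) (Or.inr ENNReal.ofReal_ne_top)
    rw [mul_zero] at h0
    refine tendsto_of_tendsto_of_tendsto_of_le_of_le tendsto_const_nhds h0 (fun _ => zero_le)
      fun k => ?_
    simp only
    rw [← lintegral_const_mul' _ _ ENNReal.ofReal_ne_top]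
    refine (enorm_integral_le_of_forall_mem (S := Metric.closedBall x₀ (R - T / 2 ^ k))
      Metric.isClosed_closedBall.measurableSet
      (fun x hx => by simp [hw, fderiv_inwardReg_eq_zero (hη k) (hRk k) hs hx])
      (fun x hx => ?_)).trans (lintegral_mono_set (closedBall_sub_subset_ball (ht k)))
    rw [enorm_mul]
    have hx2 : ‖fderiv ℝ (w k) x v‖ₑ ≤ ENNReal.ofReal (3 * L) := by
      rw [← ofReal_norm]
      exact ENNReal.ofReal_le_ofReal (hbw k x)
    refine (mul_le_mul' ((hη k).enorm_convolution_sub_self_le hM (ht k) (by linarith [ht k])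
      hf.locallyIntegrable measurableSet_ball
      (ball_subset_inter_of_mem_closedBall (s := T / 2 ^ k) (by linarith [ht k]) hx))
      hx2).trans (le_of_eq ?_)
    rw [mul_right_comm, ← ENNReal.ofReal_mul (by positivity)]
  · refine tendsto_integral_of_dominated_convergence (fun x => ‖f x‖ * (3 * L))
      (fun k => (i2 k).aestronglyMeasurable) (hf.norm.mul_const _)
      (fun k => Filter.Eventually.of_forall fun x => ?_)
      (Filter.Eventually.of_forall fun x => ?_)
    · rw [norm_mul]
      exact mul_le_mul_of_nonneg_left (hbw k x) (norm_nonneg _)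
    · exact (tendsto_fderiv_inwardReg hη hφ hc x).const_mul _

/-- The duality estimate `|∫ f ∂_v φ| ≤ C [f]_{W^{α,p}(B)} [φ]_{W^{α',p'}(ℝ^N)}`, `α + α' = 1`. -/
theorem exists_enorm_integral_mul_fderiv_le {p p' α α' : ℝ} (hp : p.HolderConjugate p')
    (hα : 0 < α) (hα' : 0 < α') (hαα' : α + α' = 1) (hN : N ≠ 0) :
    ∃ C : ℝ≥0∞, C ≠ ∞ ∧ ∀ (x₀ v : EuclideanSpace ℝ (Fin N)) (R : ℝ), 0 < R → ‖v‖ ≤ 1 →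
      ∀ f φ : EuclideanSpace ℝ (Fin N) → ℝ, Measurable f → Integrable f →
        gagliardo (Metric.ball x₀ R) α p f ≠ ∞ → ContDiff ℝ 1 φ →
        tsupport φ ⊆ Metric.ball x₀ R →
        ‖∫ x, f x * fderiv ℝ φ x v‖ₑ ≤
          C * (gagliardo (Metric.ball x₀ R) α p f * gagliardo univ α' p' φ) := by
  obtain ⟨M, hM, hmol⟩ := exists_isMollifier N
  set A := ENNReal.ofReal (4 * (M * 2 ^ (N + 1)) ^ 2) with hA
  set K := oscConst N α p * oscConst N α' p' with hK
  -- One `A * K` pays for the coarsest pairing, the other for the telescoping sum.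
  refine ⟨2 * (A * K), ENNReal.mul_ne_top (by simp) (ENNReal.mul_ne_top ENNReal.ofReal_ne_top
    (ENNReal.mul_ne_top (oscConst_ne_top N α hp.lt) (oscConst_ne_top N α' hp.symm.lt))), ?_⟩
  intro x₀ v R hR hv f φ hfm hf hfG hφ hsupp
  -- The largest scale allowed by `2t ≤ R`, and the one at which the Poincaré-type bound applies.
  set T := R / 2 with hT
  have hT0 : 0 < T := by positivity
  have hRT : R = 2 * T := by rw [hT]; ring
  have hs : Function.support φ ⊆ Metric.ball x₀ R := (subset_tsupport φ).trans hsupp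
  choose η hη using fun k : ℕ => hmol (T / 2 ^ k) (by positivity)
  set G := gagliardo (Metric.ball x₀ R) α p f * gagliardo univ α' p' φ with hG
  set I : ℕ → ℝ≥0∞ := fun k => ENNReal.ofReal (T / 2 ^ k)⁻¹ * ∫⁻ x in Metric.ball x₀ R,
    oscAvg (Metric.ball x₀ R) (T / 2 ^ k) f x * oscAvg univ (T / 2 ^ k) φ x with hI
  have hsum : ∀ n, ∑ k ∈ Finset.range n, I k ≤ K * G := fun n =>
    sum_lintegral_oscAvg_mul_le hT0 hp hα hα' hαα' hN hfm hφ.continuous.measurable n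
  set F : ℕ → ℝ := fun k => regPairing x₀ v R (T / 2 ^ k) f φ (η k) with hF
  have hstart : ‖F 0‖ₑ ≤ A * (K * G) := by
    have h0 : IsMollifier (η 0) M T := by simpa using hη 0
    have h1 := enorm_regPairing_half_le h0 hM.le hRT hf.locallyIntegrable hφ.continuous hs hv hN
    have h2 := hsum 1
    simp only [Finset.sum_range_one, hI, pow_zero, div_one] at h2
    simp only [hF, pow_zero, div_one]
    refine h1.trans (mul_le_mul' (ENNReal.ofReal_le_ofReal ?_) h2)
    nlinarith [sq_nonneg (M * 2 ^ (N + 1))]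
  have hstep : ∀ k, ‖F k - F (k + 1)‖ₑ ≤ A * I k := fun k => by
    have e : T / 2 ^ (k + 1) = T / 2 ^ k / 2 := by rw [pow_succ, ← div_div]
    have h' := hη (k + 1)
    rw [e] at h'
    have hk : 2 * (T / 2 ^ k) ≤ R := by
      rw [hRT]
      gcongr
      exact div_le_self hT0.le (one_le_pow₀ one_le_two)
    simp only [hF, e]
    exact enorm_regPairing_sub_le (hη k) h' hM.le hk hf.locallyIntegrable hφ.continuous hs hv
  have hbound : ∀ n, ‖F n‖ₑ ≤ 2 * (A * K) * G := fun n => by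
    have e1 : F n = F 0 - ∑ k ∈ Finset.range n, (F k - F (k + 1)) := by
      rw [Finset.sum_range_sub']
      ring
    calc ‖F n‖ₑ ≤ ‖F 0‖ₑ + ‖∑ k ∈ Finset.range n, (F k - F (k + 1))‖ₑ := by
          rw [e1]
          exact enorm_sub_le
      _ ≤ A * (K * G) + A * (K * G) := by
          refine add_le_add hstart ((enorm_sum_le _ _).trans ?_)
          refine (Finset.sum_le_sum fun k _ => hstep k).trans ?_
          rw [← Finset.mul_sum]
          exact mul_le_mul_right (hsum n) _
      _ = _ := by ring
  have hlim := tendsto_regPairing (v := v) hT0 hRT hM.le hp.lt hα hN hη hφ hsupp hfm hf hfG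
  exact le_of_tendsto hlim.enorm (Filter.Eventually.of_forall hbound)

end Limit

/-! ### Duality estimate on test functions and extension by density. -/

section Main

variable {N : ℕ}

theorem gagliardo_congr_ae {Ω : Set (EuclideanSpace ℝ (Fin N))} (α p : ℝ)
    {f g : EuclideanSpace ℝ (Fin N) → ℝ} (h : f =ᵐ[volume.restrict Ω] g) :
    gagliardo Ω α p f = gagliardo Ω α p g := by
  unfold gagliardo
  congr 1
  refine lintegral_congr_ae ?_
  filter_upwards [h] with x hx
  refine lintegral_congr_ae ?_
  filter_upwards [h] with y hy
  rw [hx, hy]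

theorem exists_abs_integral_mul_fderiv_le {β q : ℝ} (hβ : β ∈ Ioo (0 : ℝ) 1) (hq : 1 < q)
    (hN : N ≠ 0) :
    ∃ C : ℝ, 0 < C ∧ ∀ (x₀ v : EuclideanSpace ℝ (Fin N)) (R : ℝ), 0 < R → ‖v‖ ≤ 1 →
      ∀ f : EuclideanSpace ℝ (Fin N) → ℝ, MemSlobodeckii (Metric.ball x₀ R) β q f →
        ∀ φ : 𝓓(openBall x₀ R, ℝ),
        |∫ x, fderiv ℝ φ x v * f x| ≤
          C * (gagliardo (Metric.ball x₀ R) β q f).toReal *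
            (gagliardo univ (1 - β) q.conjExponent φ).toReal := by
  have hα' := one_sub_mem_Ioo hβ
  obtain ⟨C, hC, H⟩ := exists_enorm_integral_mul_fderiv_le (Real.HolderConjugate.conjExponent hq)
    hβ.1 hα'.1 (by ring) hN
  -- Adding `1` ensures positivity.
  refine ⟨C.toReal + 1, by positivity, fun x₀ v R hR hv f hf φ => ?_⟩
  set B := Metric.ball x₀ R with hB
  -- Only the class of `f` on `B` matters. A measurable representative extended by zero is
  -- integrable on `ℝ^N`, and its jump across the boundary is harmless because the seminorm is taken
  -- over `B`.
  set f₀ := B.indicator (hf.memLp.1.mk f) with hf₀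
  have hae : f =ᵐ[volume.restrict B] f₀ := by
    refine hf.memLp.1.ae_eq_mk.trans ?_
    exact (indicator_ae_eq_restrict measurableSet_ball).symm
  have hm : Measurable f₀ := hf.memLp.1.stronglyMeasurable_mk.measurable.indicator measurableSet_ball
  have hfin : IsFiniteMeasure (volume.restrict B) :=
    ⟨by rw [Measure.restrict_apply_univ]; exact measure_ball_lt_top⟩
  have hint : Integrable f₀ := by
    rw [hf₀, integrable_indicator_iff measurableSet_ball]
    exact (hf.memLp.integrable (by simpa using hq.le)).congr hf.memLp.1.ae_eq_mk
  have hG := gagliardo_congr_ae β q hae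
  have hsupp : tsupport φ ⊆ B := φ.tsupport_subset
  have h1 := H x₀ v R hR hv f₀ φ hm hint (hG ▸ hf.gagliardo_lt_top.ne)
    (φ.contDiff.of_le (by exact_mod_cast le_top)) hsupp
  have e : ∫ x, fderiv ℝ φ x v * f x = ∫ x, f₀ x * fderiv ℝ φ x v := by
    have h0 : ∀ x ∉ B, fderiv ℝ φ x v = 0 := fun x hx => by
      have : fderiv ℝ φ x = 0 := by
        by_contra hne
        exact hx (hsupp (support_fderiv_subset ℝ hne))
      simp [this]
    have e1 : ∫ x in B, fderiv ℝ φ x v * f x = ∫ x, fderiv ℝ φ x v * f x :=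
      setIntegral_eq_integral_of_forall_compl_eq_zero fun x hx => by rw [h0 x hx, zero_mul]
    have e2 : ∫ x in B, f₀ x * fderiv ℝ φ x v = ∫ x, f₀ x * fderiv ℝ φ x v :=
      setIntegral_eq_integral_of_forall_compl_eq_zero fun x hx => by rw [h0 x hx, mul_zero]
    rw [← e1, ← e2]
    refine integral_congr_ae ?_
    filter_upwards [hae] with x hx
    rw [hx, mul_comm]
  have hφtop := SlobodeckiiTest.gagliardo_ne_top hα' (one_le_conjExponent hq) φ
  rw [← hG] at h1
  have h2 := ENNReal.toReal_mono (ENNReal.mul_ne_top hC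
    (ENNReal.mul_ne_top hf.gagliardo_lt_top.ne hφtop)) h1
  rw [toReal_enorm, Real.norm_eq_abs, ENNReal.toReal_mul, ENNReal.toReal_mul, ← mul_assoc] at h2
  rw [e]
  refine h2.trans ?_
  gcongr
  linarith

theorem theorem2 (N : ℕ) (β q : ℝ) (hβ : β ∈ Set.Ioo (0 : ℝ) 1) (hq : 1 < q) :
    ∃ C : ℝ, 0 < C ∧
      ∀ (x₀ : EuclideanSpace ℝ (Fin N)) (R : ℝ), 0 < R →
        ∀ f : EuclideanSpace ℝ (Fin N) → ℝ, MemSlobodeckii (openBall x₀ R) β q f →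
          ∀ j : Fin N, ∃ F : NegSlobodeckii (openBall x₀ R) hβ hq,
            F.IsDistribution
              (∂_{EuclideanSpace.single j (1 : ℝ)} (distributionOfFun (openBall x₀ R) f)) ∧
            ‖F‖ ≤ C * (gagliardo (openBall x₀ R : Set (EuclideanSpace ℝ (Fin N))) β q f).toReal :=
  by
  rcases eq_or_ne N 0 with rfl | hN
  · exact ⟨1, one_pos, fun _ _ _ _ _ j => j.elim0⟩
  obtain ⟨C, hC, H⟩ := exists_abs_integral_mul_fderiv_le hβ hq hN
  refine ⟨C, hC, fun x₀ R hR f hf j => ?_⟩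
  set v : EuclideanSpace ℝ (Fin N) := EuclideanSpace.single j (1 : ℝ) with hv
  set T : 𝓓'(openBall x₀ R, ℝ) := ∂_{v} (distributionOfFun (openBall x₀ R) f) with hT
  have hfin : IsFiniteMeasure (volume.restrict (openBall x₀ R : Set (EuclideanSpace ℝ (Fin N)))) :=
    ⟨by rw [Measure.restrict_apply_univ]; exact measure_ball_lt_top⟩
  have hloc : LocallyIntegrableOn f (openBall x₀ R : Set (EuclideanSpace ℝ (Fin N))) volume :=
    IntegrableOn.locallyIntegrableOn (hf.memLp.integrable (by simpa using hq.le))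
  have hTφ : ∀ φ : 𝓓(openBall x₀ R, ℝ), T φ = -∫ x, fderiv ℝ φ x v * f x := fun φ => by
    have h1 : T φ = -distributionOfFun (openBall x₀ R) f (∂_{v} φ) := by
      rw [hT, Distribution.lineDerivOp_apply_apply, map_neg]
    have h2 : ∀ x, (∂_{v} φ : 𝓓(openBall x₀ R, ℝ)) x = fderiv ℝ φ x v := fun x => by
      rw [TestFunction.lineDerivOp_eq_lineDerivCLM ℝ,
        TestFunction.lineDerivCLM_apply_of_le (by simp),
        ((φ.contDiff.differentiable (by simp)) x).lineDeriv_eq_fderiv]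
    rw [h1, distributionOfFun]
    refine congrArg Neg.neg ((TestFunction.integralAgainstBilinCLM_eq_integral hloc).trans ?_)
    simp only [h2, ContinuousLinearMap.mul_apply']
  set G := (gagliardo (openBall x₀ R : Set (EuclideanSpace ℝ (Fin N))) β q f).toReal with hG
  have hα := one_sub_mem_Ioo hβ
  have hr := one_le_conjExponent hq
  -- The distribution is regarded as a linear form on test functions with the Gagliardo norm; the
  -- estimate makes it bounded there, and it then extends to the completion.
  let ℓ : SlobodeckiiTest (openBall x₀ R) hα hr →ₗ[ℝ] ℝ :=
    (T : 𝓓(openBall x₀ R, ℝ) →ₗ[ℝ] ℝ) ∘ₗ (SlobodeckiiTest.of hα hr).symm.toLinearMap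
  have hℓ : ∀ φ, ‖ℓ φ‖ ≤ C * G * ‖φ‖ := fun φ => by
    have h1 := H x₀ v R hR (by simp [hv]) f hf ((SlobodeckiiTest.of hα hr).symm φ)
    have h2 : ℓ φ = T ((SlobodeckiiTest.of hα hr).symm φ) := rfl
    rw [h2, hTφ, norm_neg]
    exact h1
  have hd : DenseRange (UniformSpace.Completion.toComplL :
      SlobodeckiiTest (openBall x₀ R) hα hr →L[ℝ] HomSlobodeckii (openBall x₀ R) hα hr) :=
    UniformSpace.Completion.denseRange_coe
  have hu : IsUniformInducing (UniformSpace.Completion.toComplL :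
      SlobodeckiiTest (openBall x₀ R) hα hr →L[ℝ] HomSlobodeckii (openBall x₀ R) hα hr) :=
    UniformSpace.Completion.isUniformInducing_coe _
  let ℓ' : SlobodeckiiTest (openBall x₀ R) hα hr →L[ℝ] ℝ := ℓ.mkContinuous (C * G) hℓ
  refine ⟨ℓ'.extend UniformSpace.Completion.toComplL, fun φ => ?_, ?_⟩
  · exact ℓ'.extend_eq hd hu (SlobodeckiiTest.of hα hr φ)
  · refine ContinuousLinearMap.opNorm_le_bound _ (by positivity) fun x => ?_
    induction x using UniformSpace.Completion.induction_on with
    -- Both sides are continuous on the completion, so the bound need only be checked on test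
    -- functions.
    | hp => exact isClosed_le (by fun_prop) (by fun_prop)
    | ih φ =>
      have h1 := ℓ'.extend_eq hd hu φ
      rw [UniformSpace.Completion.coe_toComplL] at h1
      rw [h1, UniformSpace.Completion.norm_coe]
      exact hℓ φ

end Main
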